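/- For a symmetric $2n\times 2n$ integer matrix $A=(a_{ij})$ let $$\mathrm{hf}(A)=\frac{1}{2^n\,n!}\sum_{\sigma\in S_{2n}}\prod_{j=1}^{n}a_{\sigma(2j-1),\sigma(2j)}$$ be its hafnian; this is an integer. Let $k$ be a fixed non-negative integer. Then: (1) There is a polynomial-time algorithm (a deterministic Turing machine whose number of steps is bounded by a polynomial in the length of its input) that, given a symmetric integer matrix $A$ of even order, with its entries written in binary, outputs the residue of $\mathrm{hf}(A)$ modulo $2^k$. (2) There is a polynomial-time algorithm that, given an arbitrary finite simple undirected graph $G$ by its adjacency matrix, outputs the residue modulo $2^k$ of the number of perfect matchings of $G$. The polynomial that bounds the running time may depend on $k$. -/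

import Mathlib

namespace HafnianModTwoPow

/-- The sum `∑ σ ∈ S_{2n}, a_{σ(1),σ(2)} a_{σ(3),σ(4)} ⋯ a_{σ(2n-1),σ(2n)}` (the `2n` indices are
`0, …, 2n-1` here, and the `n` pairs of positions are `(2j, 2j+1)` for `j < n`). -/
def hafnianSum {n : ℕ} (A : Matrix (Fin (2 * n)) (Fin (2 * n)) ℤ) : ℤ :=
  ∑ σ : Equiv.Perm (Fin (2 * n)), ∏ j : Fin n,
    A (σ ⟨2 * j.val, by have := j.isLt; omega⟩) (σ ⟨2 * j.val + 1, by have := j.isLt; omega⟩)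

/-- The hafnian `hf(A) = 1 / (2^n n!) * ∑ σ, ∏ j, a_{σ(2j-1),σ(2j)}` of a symmetric `2n × 2n`
integer matrix. For symmetric `A` the division is exact. -/
def hafnian {n : ℕ} (A : Matrix (Fin (2 * n)) (Fin (2 * n)) ℤ) : ℤ :=
  hafnianSum A / (2 ^ n * (n.factorial : ℤ))

/-- The number of perfect matchings of a graph. -/
noncomputable def numPerfectMatchings {V : Type} (G : SimpleGraph V) : ℕ :=
  {M : G.Subgraph | M.IsPerfectMatching}.ncard

/-- Symmetric integer matrices of even order. -/
structure SymmMatrix where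
  /-- half of the order -/
  n : ℕ
  /-- the matrix -/
  A : Matrix (Fin (2 * n)) (Fin (2 * n)) ℤ
  symm : A.IsSymm

/-- Finite simple graphs, with vertices numbered `0, …, m-1`. -/
structure FinGraph where
  /-- the number of vertices -/
  m : ℕ
  /-- the graph -/
  G : SimpleGraph (Fin m)

/-- The input alphabet: the two binary digits, a minus sign, a mark that ends every entry, and a
mark that ends every row. -/
inductive Sym
  | bit (b : Bool)
  | minus
  | endEntry
  | endRow
  deriving DecidableEq, Fintype

/-- An integer in binary: a minus sign if it is negative, then the binary digits of its absolute
value (least significant digit first, no digit for zero). -/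
def encodeInt (z : ℤ) : List Sym :=
  (if z < 0 then [Sym.minus] else []) ++ (Computability.encodeNat z.natAbs).map Sym.bit

/-- A square integer matrix, written entry by entry and row by row, with all entries in binary. -/
def encodeMatrix {m : ℕ} (A : Matrix (Fin m) (Fin m) ℤ) : List Sym :=
  (List.finRange m).flatMap fun i =>
    ((List.finRange m).flatMap fun j => encodeInt (A i j) ++ [Sym.endEntry]) ++ [Sym.endRow]

/-- A symmetric matrix is given to a machine as the list of all its entries. -/
def SymmMatrix.encode (X : SymmMatrix) : List Sym :=
  encodeMatrix X.A

open Classical in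
/-- A graph is given to a machine by its adjacency matrix. -/
noncomputable def FinGraph.encode (X : FinGraph) : List Sym :=
  encodeMatrix (X.G.adjMatrix ℤ)

/-- The residue of the hafnian modulo `2^k`, a number in `{0, …, 2^k - 1}`. -/
def hafnianMod (k : ℕ) (X : SymmMatrix) : ℕ :=
  (hafnian X.A % 2 ^ k).toNat

/-- The residue of the number of perfect matchings modulo `2^k`. -/
noncomputable def numPerfectMatchingsMod (k : ℕ) (X : FinGraph) : ℕ :=
  numPerfectMatchings X.G % 2 ^ k

/-- `f` is computable in polynomial time: some Turing machine (with finitely many stacks) writes,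
for every `a`, the binary expansion of `f a` when it is started on the word `enc a`, within a
number of steps that is bounded by a fixed polynomial in the length of that word. -/
def PolyTime {α : Type} (enc : α → List Sym) (f : α → ℕ) : Prop :=
  Nonempty (Turing.TM2ComputableInPolyTime enc Computability.encodeNat f)

end HafnianModTwoPow

/-!
The hafnian of a symmetric matrix is the sum, over the perfect matchings of its index set, of the
products of the entries at the matched pairs; it can be expanded along any index (`hf`,
`hf_expand`). The definition by permutations counts every matching `2 ^ n * n!` times
(`hafnianSum_eq`), and the hafnian of an adjacency matrix is the number of perfect matchings
(`hf_adjMatrix`), so that both parts follow from one algorithm for hafnians modulo `2 ^ k`.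

The algorithm rests on the fact that adding `c` times row and column `w` to row and column `u`
changes the hafnian by *twice* a combination of polynomially many hafnians of smaller matrices
(`hf_row_op`). Modulo `2 ^ (k + 1)`, these smaller hafnians are needed only modulo `2 ^ k`. So one
can do Gaussian elimination. If the row of the first index `v` has an odd entry, in column `w` say,
then row operations with `w` make all the other entries `(v, u)` even. In the expansion along `v`,
the terms with even entries again need the smaller hafnians only modulo `2 ^ k`, and the one
remaining term is an odd number times the hafnian without `v` and `w`, with which the elimination
goes on. If the row of `v` has no odd entry, then the expansion along `v` finishes the computation.
Thus precision `k + 1` costs polynomially many calls at precision `k`, and for fixed `k` the whole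
recursion is polynomial (`hafAlgo`, `computes_hafAlgo`, `PF.hafAlgo`).

For the running time on Turing machines, structured programs acting on stacks are compiled to
machines with several stacks, one step of the program being one step of the machine
(`Prog.outputs_toTM`). On top of this, `PF` is the class of functions between types encoded by
binary trees that some program computes in polynomial time. It contains the basic operations on
pairs, lists and numbers in unary notation, and it is closed under composition, case distinction and
iteration along a list as long as the intermediate results have polynomial size (`PF.iterate`).
Unary notation suffices, because all numbers that occur are polynomially bounded: they are indices,
residues modulo the fixed number `2 ^ k`, or sums of polynomially many products of residues. The
parser reduces the entries of the input while it reads them, and `polyTime_of_PF` adds the input and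
output routines.
-/

namespace HafnianModTwoPow

/-! ### The hafnian as a sum over matchings -/

section Hafnian

variable {V W : Type*} [LinearOrder V] [LinearOrder W] {R S : Type*} [CommSemiring R]
  [CommSemiring S]

/-- The hafnian of the weights `a` on a finite set of vertices, by expansion along the least
vertex. It is `0` on sets with an odd number of elements. -/
def hf (a : V → V → R) (s : Finset V) : R :=
  if h : s.Nonempty then
    ∑ w ∈ s.erase (s.min' h), a (s.min' h) w * hf a ((s.erase (s.min' h)).erase w)
  else 1
termination_by s.card
decreasing_by
  exact lt_of_le_of_lt (Finset.card_le_card (Finset.erase_subset _ _))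
    (Finset.card_erase_lt_of_mem (s.min'_mem h))

@[simp] theorem hf_empty (a : V → V → R) : hf a ∅ = 1 := by
  rw [hf]; simp

theorem hf_min' (a : V → V → R) {s : Finset V} (h : s.Nonempty) :
    hf a s = ∑ w ∈ s.erase (s.min' h), a (s.min' h) w * hf a ((s.erase (s.min' h)).erase w) := by
  rw [hf, dif_pos h]

/-- Double sums over pairs of distinct elements do not depend on the order of summation. -/
theorem sum_erase_comm (s : Finset V) (f : V → V → R) :
    ∑ x ∈ s, ∑ y ∈ s.erase x, f x y = ∑ y ∈ s, ∑ x ∈ s.erase y, f x y :=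
  Finset.sum_comm' fun x y => by simp only [Finset.mem_erase]; tauto

/-- For symmetric weights the hafnian can be expanded along any vertex. -/
theorem hf_expand {a : V → V → R} (s : Finset V) (ha : ∀ x ∈ s, ∀ y ∈ s, a x y = a y x) {v : V}
    (hv : v ∈ s) : hf a s = ∑ w ∈ s.erase v, a v w * hf a ((s.erase v).erase w) := by
  induction hn : s.card using Nat.strong_induction_on generalizing s v with
  | _ n ih =>
  subst hn
  have hne : s.Nonempty := ⟨v, hv⟩
  rw [hf_min' a hne]
  set u := s.min' hne with hu
  have hus : u ∈ s := s.min'_mem hne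
  by_cases huv : u = v
  · rw [huv]
  have card_lt : ∀ x ∈ s, ∀ y, ((s.erase x).erase y).card < s.card := fun x hx y =>
    lt_of_le_of_lt (Finset.card_le_card (Finset.erase_subset _ _)) (Finset.card_erase_lt_of_mem hx)
  have sub : ∀ x y, (s.erase x).erase y ⊆ s := fun x y =>
    (Finset.erase_subset _ _).trans (Finset.erase_subset _ _)
  have hvu : v ∈ s.erase u := Finset.mem_erase.2 ⟨Ne.symm huv, hv⟩
  have huv' : u ∈ s.erase v := Finset.mem_erase.2 ⟨huv, hus⟩
  rw [← Finset.add_sum_erase _ _ hvu, ← Finset.add_sum_erase _ _ huv']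
  congr 1
  · rw [ha u hus v hv, Finset.erase_right_comm]
  -- Apart from the term of the edge `uv`, both expansions become the double sum over the partners
  -- of `u` and of `v`.
  set t := (s.erase u).erase v with ht
  have ht' : (s.erase v).erase u = t := Finset.erase_right_comm
  rw [ht']
  have h1 : ∀ w ∈ t, hf a ((s.erase u).erase w) =
      ∑ x ∈ t.erase w, a v x * hf a ((t.erase w).erase x) := fun w hw => by
    rw [ih _ (card_lt u hus w) _ (fun x hx y hy => ha x (sub _ _ hx) y (sub _ _ hy)) (v := v) ?_
      rfl]
    · rw [ht, Finset.erase_right_comm (s := s.erase u)]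
    · simp only [ht, Finset.mem_erase] at hw ⊢; tauto
  have h2 : ∀ w ∈ t, hf a ((s.erase v).erase w) =
      ∑ x ∈ t.erase w, a u x * hf a ((t.erase w).erase x) := fun w hw => by
    rw [ih _ (card_lt v hv w) _ (fun x hx y hy => ha x (sub _ _ hx) y (sub _ _ hy)) (v := u) ?_
      rfl]
    · rw [← ht', Finset.erase_right_comm (s := s.erase v)]
    · simp only [ht, Finset.mem_erase] at hw ⊢; tauto
  have h3 : ∑ w ∈ t, a u w * hf a ((s.erase u).erase w) =
      ∑ w ∈ t, ∑ x ∈ t.erase w, a u w * (a v x * hf a ((t.erase w).erase x)) :=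
    Finset.sum_congr rfl fun w hw => by rw [h1 w hw, Finset.mul_sum]
  have h4 : ∑ w ∈ t, a v w * hf a ((s.erase v).erase w) =
      ∑ w ∈ t, ∑ x ∈ t.erase w, a v w * (a u x * hf a ((t.erase w).erase x)) :=
    Finset.sum_congr rfl fun w hw => by rw [h2 w hw, Finset.mul_sum]
  rw [h3, h4, sum_erase_comm]
  refine Finset.sum_congr rfl fun x _ => Finset.sum_congr rfl fun w _ => ?_
  rw [Finset.erase_right_comm (s := t)]
  ring

/-- The diagonal does not matter. -/
theorem hf_congr {a b : V → V → R} (s : Finset V) (h : ∀ x ∈ s, ∀ y ∈ s, x ≠ y → a x y = b x y) :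
    hf a s = hf b s := by
  induction hn : s.card using Nat.strong_induction_on generalizing s with
  | _ n ih =>
  subst hn
  rcases s.eq_empty_or_nonempty with rfl | hne
  · simp
  rw [hf_min' a hne, hf_min' b hne]
  refine Finset.sum_congr rfl fun w hw => ?_
  have hm := s.min'_mem hne
  rw [h _ hm w (Finset.mem_of_mem_erase hw) (Finset.ne_of_mem_erase hw).symm,
    ih _ (lt_of_le_of_lt (Finset.card_le_card (Finset.erase_subset _ _))
      (Finset.card_erase_lt_of_mem hm)) _ (fun x hx y hy => h x ?_ y ?_) rfl]
  · exact Finset.mem_of_mem_erase (Finset.mem_of_mem_erase hx)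
  · exact Finset.mem_of_mem_erase (Finset.mem_of_mem_erase hy)

theorem map_hf (φ : R →+* S) (a : V → V → R) (s : Finset V) :
    φ (hf a s) = hf (fun x y => φ (a x y)) s := by
  induction hn : s.card using Nat.strong_induction_on generalizing s with
  | _ n ih =>
  subst hn
  rcases s.eq_empty_or_nonempty with rfl | hne
  · simp
  rw [hf_min' a hne, hf_min' _ hne, map_sum]
  refine Finset.sum_congr rfl fun w hw => ?_
  rw [map_mul, ih _ (lt_of_le_of_lt (Finset.card_le_card (Finset.erase_subset _ _))
      (Finset.card_erase_lt_of_mem (s.min'_mem hne))) _ rfl]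

/-- Hafnians do not depend on the names of the vertices, nor on their order. -/
theorem hf_image (e : V → W) (he : Function.Injective e) (a : W → W → R) (s : Finset V)
    (ha : ∀ x ∈ s, ∀ y ∈ s, a (e x) (e y) = a (e y) (e x)) :
    hf a (s.image e) = hf (fun x y => a (e x) (e y)) s := by
  induction hn : s.card using Nat.strong_induction_on generalizing s with
  | _ n ih =>
  subst hn
  rcases s.eq_empty_or_nonempty with rfl | ⟨v, hv⟩
  · simp
  rw [hf_expand s ha hv, hf_expand (s.image e) (by simpa using ha) (Finset.mem_image_of_mem e hv),
    ← Finset.image_erase he, Finset.sum_image he.injOn]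
  refine Finset.sum_congr rfl fun w hw => ?_
  rw [← Finset.image_erase he, ih _ (lt_of_le_of_lt (Finset.card_le_card (Finset.erase_subset _ _))
      (Finset.card_erase_lt_of_mem hv)) _ (fun x hx y hy => ha x ?_ y ?_) rfl]
  · exact Finset.mem_of_mem_erase (Finset.mem_of_mem_erase hx)
  · exact Finset.mem_of_mem_erase (Finset.mem_of_mem_erase hy)

/-- The sum over ordered pairs is twice the sum over increasing pairs. -/
theorem sum_sum_erase_eq_two_mul (s : Finset V) (f : V → V → R)
    (hf : ∀ x ∈ s, ∀ y ∈ s, f x y = f y x) :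
    ∑ x ∈ s, ∑ y ∈ s.erase x, f x y = 2 * ∑ x ∈ s, ∑ y ∈ s, if x < y then f x y else 0 := by
  have h1 : ∀ x ∈ s, ∑ y ∈ s.erase x, f x y =
      ∑ y ∈ s, (if x < y then f x y else 0) + ∑ y ∈ s, if y < x then f y x else 0 := fun x hx => by
    rw [← Finset.sum_add_distrib, ← Finset.add_sum_erase s _ hx]
    simp only [lt_irrefl, if_false, add_zero, zero_add]
    refine Finset.sum_congr rfl fun y hy => ?_
    rcases lt_or_gt_of_ne (Finset.ne_of_mem_erase hy) with h | h
    · simp [h, h.not_gt, hf x hx y (Finset.mem_of_mem_erase hy)]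
    · simp [h, h.not_gt]
  rw [Finset.sum_congr rfl h1, Finset.sum_add_distrib, two_mul]
  congr 1
  exact Finset.sum_comm

/-- Adding `c` times row and column `w` to row and column `u` changes the hafnian by twice a
combination of hafnians of smaller matrices: in the hafnian in which `u` is a copy of `w`, matchings
come in pairs that exchange the partners of `u` and `w`. -/
theorem hf_row_op {a b : V → V → R} {s : Finset V} {u w : V} (c : R) (hu : u ∈ s) (hw : w ∈ s)
    (huw : u ≠ w) (ha : ∀ x ∈ s, ∀ y ∈ s, a x y = a y x) (hb : ∀ x ∈ s, ∀ y ∈ s, b x y = b y x)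
    (hab : ∀ x ∈ s.erase u, ∀ y ∈ s.erase u, x ≠ y → b x y = a x y) (hbw : b u w = a u w)
    (hbu : ∀ q ∈ (s.erase u).erase w, b u q = a u q + c * a w q) :
    hf b s = hf a s + 2 * (c * ∑ p ∈ (s.erase u).erase w, ∑ q ∈ (s.erase u).erase w,
      if p < q then a w p * a w q * hf a ((((s.erase u).erase w).erase p).erase q) else 0) := by
  have hwu : w ∈ s.erase u := Finset.mem_erase.2 ⟨huw.symm, hw⟩
  set t := (s.erase u).erase w with ht
  have hts : t ⊆ s := (Finset.erase_subset _ _).trans (Finset.erase_subset _ _)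
  have h1 : ∀ q, hf b ((s.erase u).erase q) = hf a ((s.erase u).erase q) := fun q =>
    hf_congr _ fun x hx y hy => hab x (Finset.mem_of_mem_erase hx) y (Finset.mem_of_mem_erase hy)
  have h2 : ∀ q ∈ t, hf a ((s.erase u).erase q) =
      ∑ p ∈ t.erase q, a w p * hf a ((t.erase q).erase p) := fun q hq => by
    rw [hf_expand _ (fun x hx y hy => ha x (Finset.mem_of_mem_erase (Finset.mem_of_mem_erase hx)) y
      (Finset.mem_of_mem_erase (Finset.mem_of_mem_erase hy))) (v := w),
      Finset.erase_right_comm]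
    simp only [ht, Finset.mem_erase] at hq ⊢
    tauto
  have h3 := sum_sum_erase_eq_two_mul t (fun q p => a w q * a w p * hf a ((t.erase q).erase p))
    fun x _ y _ => by rw [Finset.erase_right_comm]; ring
  rw [hf_expand s hb hu, hf_expand s ha hu, ← Finset.add_sum_erase _ _ hwu,
    ← Finset.add_sum_erase _ _ hwu, hbw, h1 w, add_assoc]
  congr 1
  rw [mul_left_comm, ← h3, Finset.mul_sum, ← Finset.sum_add_distrib]
  refine Finset.sum_congr rfl fun q hq => ?_
  rw [hbu q hq, h1 q, add_mul]
  congr 1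
  rw [h2 q hq, Finset.mul_sum, Finset.mul_sum]
  exact Finset.sum_congr rfl fun p _ => by ring

end Hafnian

/-! ### The hafnian as a sum over permutations -/

section Orderings

variable {V : Type} [LinearOrder V] [Fintype V] {R : Type*} [CommSemiring R]

open Classical in
/-- The sum of `F` over all sequences of `m` distinct elements of `s`. -/
noncomputable def seqSum (m : ℕ) (s : Finset V) (F : (Fin m → V) → R) : R :=
  ∑ f : Fin m → V, if Function.Injective f ∧ ∀ i, f i ∈ s then F f else 0

theorem seqSum_succ (m : ℕ) (s : Finset V) (F : (Fin (m + 1) → V) → R) :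
    seqSum (m + 1) s F = ∑ v ∈ s, seqSum m (s.erase v) fun g => F (Fin.cons v g) := by
  classical
  have key : ∀ (v : V) (g : Fin m → V), (Function.Injective (Fin.cons v g : Fin (m + 1) → V) ∧
      ∀ i, (Fin.cons v g : Fin (m + 1) → V) i ∈ s) ↔
      v ∈ s ∧ Function.Injective g ∧ ∀ i, g i ∈ s.erase v := fun v g => by
    rw [Fin.cons_injective_iff, Fin.forall_fin_succ]
    simp only [Fin.cons_zero, Fin.cons_succ, Finset.mem_erase, Set.mem_range, not_exists]
    constructor
    · rintro ⟨⟨h1, h2⟩, h3, h4⟩; exact ⟨h3, h2, fun i => ⟨h1 i, h4 i⟩⟩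
    · rintro ⟨h3, h2, h4⟩; exact ⟨⟨fun i => (h4 i).1, h2⟩, h3, fun i => (h4 i).2⟩
  unfold seqSum
  rw [← Equiv.sum_comp (Fin.consEquiv fun _ : Fin (m + 1) => V), Fintype.sum_prod_type,
    ← Finset.sum_subset (Finset.subset_univ s)]
  · refine Finset.sum_congr rfl fun v hv => Finset.sum_congr rfl fun g _ => ?_
    exact if_congr ((key v g).trans (and_iff_right hv)) rfl rfl
  · intro v _ hv
    exact Finset.sum_eq_zero fun g _ => if_neg fun h => hv ((key v g).1 h).1

/-- The product of the weights of the `n` consecutive pairs of a sequence. -/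
def pairProd (a : V → V → R) (n : ℕ) (f : Fin (2 * n) → V) : R :=
  ∏ j : Fin n, a (f ⟨2 * j.val, by have := j.isLt; omega⟩)
    (f ⟨2 * j.val + 1, by have := j.isLt; omega⟩)

/-- The sum over all sequences of `2n` distinct elements of `s` of the product of the weights of the
`n` consecutive pairs. -/
noncomputable def orderingSum (a : V → V → R) (n : ℕ) (s : Finset V) : R :=
  seqSum (2 * n) s (pairProd a n)

theorem orderingSum_succ (a : V → V → R) (n : ℕ) (s : Finset V) :
    orderingSum a (n + 1) s =
      ∑ v ∈ s, ∑ w ∈ s.erase v, a v w * orderingSum a n ((s.erase v).erase w) := by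
  classical
  refine (seqSum_succ (2 * n + 1) s _).trans (Finset.sum_congr rfl fun v _ => ?_)
  refine (seqSum_succ (2 * n) _ _).trans (Finset.sum_congr rfl fun w _ => ?_)
  unfold orderingSum seqSum
  rw [Finset.mul_sum]
  refine Finset.sum_congr rfl fun f _ => ?_
  rw [mul_ite, mul_zero]
  refine if_congr Iff.rfl ?_ rfl
  exact Fin.prod_univ_succ _

/-- Every matching of `s` is listed by `2 ^ n * n!` sequences. The induction needs no count of them:
by `orderingSum_succ`, the first element `v` can be any of the `2n` elements of `s`, and each choice
contributes the expansion of the hafnian along `v`. -/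
theorem orderingSum_eq {a : V → V → R} (n : ℕ) (s : Finset V)
    (ha : ∀ x ∈ s, ∀ y ∈ s, a x y = a y x) (hs : s.card = 2 * n) :
    orderingSum a n s = 2 ^ n * n.factorial * hf a s := by
  induction n generalizing s with
  | zero =>
    have : s = ∅ := by simpa using hs
    subst this
    simp [orderingSum, seqSum, pairProd, Function.injective_of_subsingleton]
  | succ n ih =>
    have h1 : ∀ v ∈ s, ∑ w ∈ s.erase v, a v w * orderingSum a n ((s.erase v).erase w) =
        2 ^ n * n.factorial * hf a s := fun v hv => by
      rw [hf_expand s ha hv, Finset.mul_sum]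
      refine Finset.sum_congr rfl fun w hw => ?_
      rw [ih _ (fun x hx y hy => ha x (Finset.mem_of_mem_erase (Finset.mem_of_mem_erase hx)) y
        (Finset.mem_of_mem_erase (Finset.mem_of_mem_erase hy)))]
      · ring
      · rw [Finset.card_erase_of_mem hw, Finset.card_erase_of_mem hv]; omega
    rw [orderingSum_succ, Finset.sum_congr rfl h1, Finset.sum_const, hs, nsmul_eq_mul,
      Nat.factorial_succ]
    push_cast
    ring

end Orderings

theorem hafnianSum_eq {n : ℕ} (A : Matrix (Fin (2 * n)) (Fin (2 * n)) ℤ) (hA : A.IsSymm) :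
    hafnianSum A = 2 ^ n * (n.factorial : ℤ) * hf A Finset.univ := by
  rw [← orderingSum_eq n Finset.univ (fun x _ y _ => hA.apply y x) (by simp)]
  classical
  refine Fintype.sum_of_injective (fun σ : Equiv.Perm (Fin (2 * n)) => ⇑σ) DFunLike.coe_injective
    _ _ (fun f hf => ?_) (fun σ => ?_)
  · rw [if_neg]
    rintro ⟨h, -⟩
    exact hf ⟨Equiv.ofBijective f (Finite.injective_iff_bijective.1 h), rfl⟩
  · rw [if_pos ⟨σ.injective, fun _ => Finset.mem_univ _⟩]
    rfl

theorem hafnian_eq {n : ℕ} (A : Matrix (Fin (2 * n)) (Fin (2 * n)) ℤ) (hA : A.IsSymm) :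
    hafnian A = hf A Finset.univ := by
  rw [hafnian, hafnianSum_eq A hA]
  exact Int.mul_ediv_cancel_left _ (by positivity)

/-! ### The hafnian as the number of perfect matchings -/

section Matchings

variable {V : Type} [LinearOrder V] (G : SimpleGraph V)

/-- The permutation exchanges matched vertices of `s` and fixes all other vertices. -/
def IsMatchingPerm (s : Finset V) (σ : Equiv.Perm V) : Prop :=
  (∀ x, σ (σ x) = x) ∧ (∀ x ∈ s, G.Adj x (σ x)) ∧ ∀ x ∉ s, σ x = x

open Classical in
/-- The permutations that describe the perfect matchings of the subgraph induced on `s`. -/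
noncomputable def matchingPerms [Fintype V] (s : Finset V) : Finset (Equiv.Perm V) :=
  Finset.univ.filter (IsMatchingPerm G s)

variable {G}

theorem IsMatchingPerm.mem {s : Finset V} {σ : Equiv.Perm V} (h : IsMatchingPerm G s σ) {x : V}
    (hx : x ∈ s) : σ x ∈ s.erase x := by
  have hadj := h.2.1 x hx
  refine Finset.mem_erase.2 ⟨hadj.ne', ?_⟩
  by_contra hn
  have := h.2.2 _ hn
  rw [h.1] at this
  exact hadj.ne this

/-- Removing a matched pair from a matching. -/
theorem IsMatchingPerm.mul_swap {s : Finset V} {σ : Equiv.Perm V} (h : IsMatchingPerm G s σ)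
    {v w : V} (hvw : σ v = w) :
    IsMatchingPerm G ((s.erase v).erase w) (σ * Equiv.swap v w) := by
  have hwv : σ w = v := by rw [← hvw, h.1]
  have e : ∀ x, (σ * Equiv.swap v w) x = if x = v ∨ x = w then x else σ x := fun x => by
    rw [Equiv.Perm.mul_apply, Equiv.swap_apply_def]
    split_ifs <;> simp_all
  refine ⟨fun x => ?_, fun x hx => ?_, fun x hx => ?_⟩
  · rw [e x]
    split_ifs with hx
    · rw [e, if_pos hx]
    · rw [e, if_neg, h.1]
      rintro (h' | h')
      · exact hx (.inr (by rw [← h.1 x, h', hvw]))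
      · exact hx (.inl (by rw [← h.1 x, h', hwv]))
  · simp only [Finset.mem_erase] at hx
    rw [e, if_neg (by tauto)]
    exact h.2.1 x hx.2.2
  · rw [e]
    split_ifs with h'
    · rfl
    · simp only [Finset.mem_erase] at hx
      exact h.2.2 x (by tauto)

/-- Adding a matched pair to a matching. -/
theorem IsMatchingPerm.mul_swap' {s : Finset V} {σ : Equiv.Perm V} {v w : V}
    (h : IsMatchingPerm G ((s.erase v).erase w) σ) (hv : v ∈ s) (hw : w ∈ s) (hvw : G.Adj v w) :
    IsMatchingPerm G s (σ * Equiv.swap v w) ∧ (σ * Equiv.swap v w) v = w := by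
  have h1 : σ v = v := h.2.2 v (by simp)
  have h2 : σ w = w := h.2.2 w (by simp)
  have hne := hvw.ne
  have e : ∀ x, (σ * Equiv.swap v w) x = if x = v then w else if x = w then v else σ x :=
      fun x => by
    rw [Equiv.Perm.mul_apply, Equiv.swap_apply_def]
    split_ifs <;> simp_all
  refine ⟨⟨fun x => ?_, fun x hx => ?_, fun x hx => ?_⟩, by rw [e, if_pos rfl]⟩
  · rw [e x]
    split_ifs with hx hx'
    · rw [e, if_neg hne.symm, if_pos rfl, hx]
    · rw [e, if_pos rfl, hx']
    · rw [e, if_neg, if_neg, h.1]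
      · intro h'; exact hx' (by rw [← h.1 x, h', h2])
      · intro h'; exact hx (by rw [← h.1 x, h', h1])
  · rw [e]
    split_ifs with h1 h2
    · rw [h1]; exact hvw
    · rw [h2]; exact hvw.symm
    · exact h.2.1 x (by simp [h1, h2, hx])
  · rw [e, if_neg (by rintro rfl; exact hx hv), if_neg (by rintro rfl; exact hx hw)]
    exact h.2.2 x (by simp [hx])

variable [Fintype V]

open Classical in
/-- The matchings of `s`, sorted by the partner `w` of `v`: multiplication by the transposition of
`v` and `w` removes and restores this pair. -/
theorem card_matchingPerms_eq_sum {s : Finset V} {v : V} (hv : v ∈ s) :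
    (matchingPerms G s).card = ∑ w ∈ s.erase v,
      (if G.Adj v w then 1 else 0) * (matchingPerms G ((s.erase v).erase w)).card := by
  rw [Finset.card_eq_sum_card_fiberwise (f := fun σ : Equiv.Perm V => σ v) (t := s.erase v)]
  · refine Finset.sum_congr rfl fun w hw => ?_
    split_ifs with hvw
    · rw [one_mul]
      refine Finset.card_nbij' (fun σ => σ * Equiv.swap v w) (fun σ => σ * Equiv.swap v w)
        ?_ ?_ ?_ ?_
      · intro σ hσ
        simp only [matchingPerms, Finset.coe_filter, Finset.mem_filter, Finset.mem_univ, true_and,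
          Set.mem_ofPred_eq] at hσ ⊢
        exact hσ.1.mul_swap hσ.2
      · intro σ hσ
        simp only [matchingPerms, Finset.coe_filter, Finset.mem_filter, Finset.mem_univ, true_and,
          Set.mem_ofPred_eq] at hσ ⊢
        exact hσ.mul_swap' hv (Finset.mem_of_mem_erase hw) hvw
      · intro σ _; simp [mul_assoc]
      · intro σ _; simp [mul_assoc]
    · rw [zero_mul, Finset.card_eq_zero, Finset.filter_eq_empty_iff]
      intro σ hσ h
      simp only [matchingPerms, Finset.mem_filter, Finset.mem_univ, true_and] at hσ
      exact hvw (h ▸ hσ.2.1 v hv)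
  · intro σ hσ
    simp only [matchingPerms, Finset.coe_filter, Finset.mem_univ, true_and,
      Set.mem_ofPred_eq] at hσ
    exact hσ.mem hv

open Classical in
theorem card_matchingPerms (s : Finset V) :
    (matchingPerms G s).card = hf (fun x y => if G.Adj x y then 1 else 0) s := by
  induction hn : s.card using Nat.strong_induction_on generalizing s with
  | _ n ih =>
  subst hn
  rcases s.eq_empty_or_nonempty with rfl | ⟨v, hv⟩
  · rw [hf_empty, Finset.card_eq_one]
    refine ⟨1, ?_⟩
    ext σ
    simp only [matchingPerms, IsMatchingPerm, Finset.mem_filter, Finset.mem_univ, true_and,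
      Finset.notMem_empty, not_false_eq_true, forall_const, Finset.mem_singleton]
    constructor
    · rintro ⟨-, -, h⟩; exact Equiv.ext h
    · rintro rfl; simp
  · rw [hf_expand s (fun x _ y _ => by simp [G.adj_comm]) hv, card_matchingPerms_eq_sum hv]
    refine Finset.sum_congr rfl fun w _ => ?_
    rw [ih _ (lt_of_le_of_lt (Finset.card_le_card (Finset.erase_subset _ _))
      (Finset.card_erase_lt_of_mem hv)) _ rfl]

/-- The spanning subgraph with edges `{x, σ x}`. -/
def permSubgraph {σ : Equiv.Perm V} (h : IsMatchingPerm G Finset.univ σ) : G.Subgraph where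
  verts := Set.univ
  Adj x y := σ x = y
  adj_sub := fun {x y} (hxy : σ x = y) => hxy ▸ h.2.1 x (Finset.mem_univ x)
  edge_vert := fun _ => Set.mem_univ _
  symm := ⟨fun x y hxy => by rw [← hxy, h.1]⟩

theorem numPerfectMatchings_eq_card :
    numPerfectMatchings G = (matchingPerms G Finset.univ).card := by
  classical
  rw [numPerfectMatchings, ← Set.ncard_coe_finset]
  symm
  have hmem : ∀ {σ}, σ ∈ (matchingPerms G Finset.univ : Set (Equiv.Perm V)) →
      IsMatchingPerm G Finset.univ σ := fun {σ} hσ => by simpa [matchingPerms] using hσ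
  refine Set.ncard_congr (fun σ hσ => permSubgraph (hmem hσ)) ?_ ?_ ?_
  · intro σ hσ
    refine ⟨fun x _ => ⟨σ x, rfl, fun y hy => ?_⟩, fun x => Set.mem_univ x⟩
    exact Eq.symm hy
  · intro σ τ hσ hτ h
    ext x
    have h1 : (permSubgraph (hmem hσ)).Adj x (σ x) := rfl
    rw [h] at h1
    exact Eq.symm h1
  · intro M hM
    choose p hp hp' using fun x : V => hM.1 (hM.2 x)
    have hinv : Function.Involutive p := fun x => (hp' _ _ (hp x).symm).symm
    have hσ : IsMatchingPerm G Finset.univ hinv.toPerm :=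
      ⟨hinv, fun x _ => M.adj_sub (hp x), by simp⟩
    refine ⟨hinv.toPerm, by simpa [matchingPerms] using hσ, ?_⟩
    refine SimpleGraph.Subgraph.ext ?_ ?_
    · exact (Set.eq_univ_of_forall hM.2).symm
    · funext x y
      refine propext ⟨fun h => ?_, fun h => (hp' x y h).symm⟩
      have : p x = y := h
      rw [← this]
      exact hp x

open Classical in
theorem hf_adjMatrix : hf (G.adjMatrix ℤ) Finset.univ = (numPerfectMatchings G : ℤ) := by
  rw [numPerfectMatchings_eq_card, card_matchingPerms]
  refine Eq.trans ?_ (map_hf (Nat.castRingHom ℤ) _ _).symm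
  refine hf_congr _ fun x _ y _ _ => ?_
  simp [SimpleGraph.adjMatrix_apply]

end Matchings

/-! ### Structured programs on stacks and their compilation -/

open Turing

/-- Structured programs acting on stacks `Γ k` and a finite register `σ`. -/
inductive Prog {K : Type} (Γ : K → Type) (σ : Type)
  | push (k : K) (f : σ → Γ k)
  | pop (k : K) (f : σ → Option (Γ k) → σ)
  | load (f : σ → σ)
  | seq (p q : Prog Γ σ)
  | cond (c : σ → Bool) (p q : Prog Γ σ)
  | loop (c : σ → Bool) (p : Prog Γ σ)

namespace Prog

variable {K : Type} {Γ : K → Type} {σ : Type}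

/-- The label type of the compiled program: one label for each instruction and each test. -/
def Lab : Prog Γ σ → Type
  | push _ _ => Unit
  | pop _ _ => Unit
  | load _ => Unit
  | seq p q => Lab p ⊕ Lab q
  | cond _ p q => Option (Lab p ⊕ Lab q)
  | loop _ p => Option (Lab p)

/-- The label types are finite. -/
@[reducible] def labFintype : (p : Prog Γ σ) → Fintype p.Lab
  | push _ _ => inferInstanceAs (Fintype Unit)
  | pop _ _ => inferInstanceAs (Fintype Unit)
  | load _ => inferInstanceAs (Fintype Unit)
  | seq p q => @instFintypeSum _ _ (labFintype p) (labFintype q)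
  | cond _ p q => @instFintypeOption _ (@instFintypeSum _ _ (labFintype p) (labFintype q))
  | loop _ p => @instFintypeOption _ (labFintype p)

/-- The label at which the compiled program is entered. -/
def entry : (p : Prog Γ σ) → p.Lab
  | push _ _ => ()
  | pop _ _ => ()
  | load _ => ()
  | seq p _ => Sum.inl (entry p)
  | cond _ _ _ => none
  | loop _ _ => none

/-- The code of a program inside a machine with labels `L`, given an embedding `e` of its labels
and the label `x` to which it jumps when it is done. -/
def code {L : Type} : (p : Prog Γ σ) → (p.Lab → L) → L → p.Lab → TM2.Stmt Γ L σ
  | push k f, _, x, _ => .push k f (.goto fun _ => x)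
  | pop k f, _, x, _ => .pop k f (.goto fun _ => x)
  | load f, _, x, _ => .load f (.goto fun _ => x)
  | seq p q, e, _, .inl l => code p (fun l => e (.inl l)) (e (.inr (entry q))) l
  | seq _ q, e, x, .inr l => code q (fun l => e (.inr l)) x l
  | cond c p q, e, _, none =>
    .branch c (.goto fun _ => e (some (.inl (entry p)))) (.goto fun _ => e (some (.inr (entry q))))
  | cond _ p _, e, x, some (.inl l) => code p (fun l => e (some (.inl l))) x l
  | cond _ _ q, e, x, some (.inr l) => code q (fun l => e (some (.inr l))) x l
  | loop c p, e, x, none => .branch c (.goto fun _ => e (some (entry p))) (.goto fun _ => x)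
  | loop _ p, e, _, some l => code p (fun l => e (some l)) (e none) l

variable [DecidableEq K]

/-- Big-step semantics: `Run p v S v' S' t` says that `p`, started with register `v` and stacks `S`,
ends with register `v'` and stacks `S'` after `t` steps. -/
inductive Run : Prog Γ σ → σ → (∀ k, List (Γ k)) → σ → (∀ k, List (Γ k)) → ℕ → Prop
  | push {k f v S} : Run (push k f) v S v (Function.update S k (f v :: S k)) 1
  | pop {k f v S} : Run (pop k f) v S (f v (S k).head?) (Function.update S k (S k).tail) 1
  | load {f v S} : Run (load f) v S (f v) S 1
  | seq {p q v S v' S' v'' S'' t t'} : Run p v S v' S' t → Run q v' S' v'' S'' t' →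
      Run (seq p q) v S v'' S'' (t + t')
  | cond_true {c p q v S v' S' t} : c v = true → Run p v S v' S' t →
      Run (cond c p q) v S v' S' (t + 1)
  | cond_false {c p q v S v' S' t} : c v = false → Run q v S v' S' t →
      Run (cond c p q) v S v' S' (t + 1)
  | loop_false {c p v S} : c v = false → Run (loop c p) v S v S 1
  | loop_true {c p v S v' S' v'' S'' t t'} : c v = true → Run p v S v' S' t →
      Run (loop c p) v' S' v'' S'' t' → Run (loop c p) v S v'' S'' (t + t' + 1)

/-- A run of `p` is matched step by step by the machine that contains the code of `p`, from the
entry of `p` to the exit label `x`. -/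
theorem step_code_iterate {L : Type} {m : L → TM2.Stmt Γ L σ} {p : Prog Γ σ} {v S v' S' t}
    (h : Run p v S v' S' t) : ∀ (e : p.Lab → L) (x : L), (∀ l, m (e l) = p.code e x l) →
      (flip bind (TM2.step m))^[t] (some ⟨some (e p.entry), v, S⟩ : Option (TM2.Cfg Γ L σ)) =
        some ⟨some x, v', S'⟩ := by
  induction h with
  | @push k f v S =>
    intro e x hm
    exact congrArg (fun q => some (TM2.stepAux q v S)) (hm ())
  | @pop k f v S =>
    intro e x hm
    exact congrArg (fun q => some (TM2.stepAux q v S)) (hm ())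
  | @load f v S =>
    intro e x hm
    exact congrArg (fun q => some (TM2.stepAux q v S)) (hm ())
  | @seq p q v S v' S' v'' S'' t t' _ _ ih1 ih2 =>
    intro e x hm
    rw [add_comm, Function.iterate_add_apply]
    have h1 := ih1 (fun l => e (.inl l)) (e (.inr q.entry)) (fun l => hm (.inl l))
    have h2 := ih2 (fun l => e (.inr l)) x (fun l => hm (.inr l))
    exact (congrArg _ h1).trans h2
  | @cond_true c p q v S v' S' t hc _ ih =>
    intro e x hm
    have h1 := ih (fun l => e (some (.inl l))) x (fun l => hm (some (.inl l)))
    rw [Function.iterate_succ_apply, ← h1]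
    refine congrArg _ ((congrArg (fun q => some (TM2.stepAux q v S)) (hm none)).trans ?_)
    simp [code, hc]
  | @cond_false c p q v S v' S' t hc _ ih =>
    intro e x hm
    have h1 := ih (fun l => e (some (.inr l))) x (fun l => hm (some (.inr l)))
    rw [Function.iterate_succ_apply, ← h1]
    refine congrArg _ ((congrArg (fun q => some (TM2.stepAux q v S)) (hm none)).trans ?_)
    simp [code, hc]
  | @loop_false c p v S hc =>
    intro e x hm
    refine (congrArg (fun q => some (TM2.stepAux q v S)) (hm none)).trans ?_
    simp [code, hc]
  | @loop_true c p v S v' S' v'' S'' t t' hc _ _ ih1 ih2 =>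
    intro e x hm
    have h1 := ih1 (fun l => e (some l)) (e none) (fun l => hm (some l))
    have h2 := ih2 e x hm
    rw [Function.iterate_succ_apply, add_comm t, Function.iterate_add_apply, ← h2]
    refine congrArg _ (Eq.trans (congrArg _ ?_) h1)
    refine (congrArg (fun q => some (TM2.stepAux q v S)) (hm none)).trans ?_
    simp [code, hc]

/-- A step pushes at most one symbol, so running times bound the lengths of all stacks. -/
theorem Run.length_le {p : Prog Γ σ} {v S v' S' t} (h : Run p v S v' S' t) (k : K) :
    (S' k).length ≤ (S k).length + t := by
  induction h with
  | @push k' f v S =>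
    by_cases hk : k = k'
    · subst hk; simp
    · simp [Function.update_of_ne hk]
  | @pop k' f v S =>
    by_cases hk : k = k'
    · subst hk; simp; omega
    · simp [Function.update_of_ne hk]
  | _ => omega

/-- The Turing machine that runs the program `p`. The label `none` is the exit of the program, where
the machine halts. -/
def toTM (p : Prog Γ σ) (k₀ k₁ : K) [Fintype K] [Fintype σ] [Fintype (Γ k₀)] (v₀ : σ) : FinTM2 :=
  letI := labFintype p
  { k₀ := k₀
    k₁ := k₁
    Γ := Γ
    Λ := Option p.Lab
    main := some p.entry
    σ := σ
    initialState := v₀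
    m := fun l => match l with
      | none => .halt
      | some l => p.code some none l }

/-- The form in which Mathlib writes the stacks of an initial or final configuration. -/
theorem dite_eq_update (k₀ : K) (l : List (Γ k₀)) (k : K) :
    (if h : k = k₀ then (by rw [h]; exact l) else [] : List (Γ k)) =
      Function.update (fun _ => []) k₀ l k := by
  by_cases hk : k = k₀
  · subst hk; simp
  · simp [hk]

/-- A terminating run of the program from the initial to the final configuration is a computation
of the machine. -/
theorem outputs_toTM (p : Prog Γ σ) (k₀ k₁ : K) [Fintype K] [Fintype σ] [Fintype (Γ k₀)] (v₀ : σ)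
    {l : List (Γ k₀)} {l' : List (Γ k₁)} {t T : ℕ}
    (h : Run p v₀ (Function.update (fun _ => []) k₀ l) v₀ (Function.update (fun _ => []) k₁ l') t)
    (ht : t + 1 ≤ T) :
    Nonempty (TM2OutputsInTime (p.toTM k₀ k₁ v₀) l (some l') T) := by
  refine ⟨⟨⟨t + 1, ?_⟩, ht⟩⟩
  have h1 := step_code_iterate (m := (p.toTM k₀ k₁ v₀).m) h some none (fun l => rfl)
  have hi : initList (p.toTM k₀ k₁ v₀) l =
      ⟨some (some p.entry), v₀, Function.update (fun _ => []) k₀ l⟩ := by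
    unfold initList
    congr 1
    funext k
    exact dite_eq_update k₀ l k
  have hf : haltList (p.toTM k₀ k₁ v₀) l' =
      ⟨none, v₀, Function.update (fun _ => []) k₁ l'⟩ := by
    unfold haltList
    congr 1
    funext k
    exact dite_eq_update k₁ l' k
  rw [add_comm, Function.iterate_add_apply]
  refine (congrArg _ (Eq.trans (congrArg _ (congrArg some hi)) h1)).trans ?_
  refine Eq.trans ?_ (congrArg some hf).symm
  rfl

end Prog

/-! ### Trees on a stack -/

/-- The stacks of the machine that hold symbols of the input alphabet; one more stack receives the
output. Trees are processed on `main`, and `store` keeps what is needed later. The stacks `tmp₁` and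
`tmp₂` are buffers, `cnt` is a counter, and `inp` receives the input. -/
inductive Stk
  | main | store | tmp₁ | tmp₂ | cnt | inp
  deriving DecidableEq

instance : Fintype Stk :=
  ⟨{.main, .store, .tmp₁, .tmp₂, .cnt, .inp}, fun x => by cases x <;> decide⟩

/-- The alphabets of the stacks; the index `none` stands for the output stack. -/
abbrev Alph : Option Stk → Type
  | none => Bool
  | some _ => Sym

/-- All stack contents, from those of the symbol stacks and that of the output stack. -/
def stk (f : Stk → List Sym) (O : List Bool) : ∀ k, List (Alph k)
  | none => O
  | some k => f k

theorem update_stk (f : Stk → List Sym) (O : List Bool) (k : Stk) (l : List Sym) :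
    Function.update (stk f O) (some k) l = stk (Function.update f k l) O := by
  funext k'
  rcases k' with _ | k'
  · rfl
  · by_cases h : k' = k
    · subst h; simp [stk]
    · rw [Function.update_of_ne (by simpa using h)]
      simp [stk, h]

/-- Programs whose register holds the symbol popped last. -/
abbrev SProg := Prog Alph (Option Sym)

/-- `p` leads from the register `v` and the stacks `f` to `v'` and `f'` in at most `T` steps, with
the output stack empty. -/
def Exec (p : SProg) (v : Option Sym) (f : Stk → List Sym) (v' : Option Sym) (f' : Stk → List Sym)
    (T : ℕ) : Prop :=
  ∃ t ≤ T, Prog.Run p v (stk f []) v' (stk f' []) t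

namespace Exec

variable {p q : SProg} {v v' v'' : Option Sym} {f f' f'' : Stk → List Sym} {T T' : ℕ}

theorem mono (h : Exec p v f v' f' T) (hT : T ≤ T') : Exec p v f v' f' T' :=
  let ⟨t, ht, r⟩ := h
  ⟨t, ht.trans hT, r⟩

theorem of_eq (h : Exec p v f v' f' T) (hf : f' = f'') (hT : T ≤ T') : Exec p v f v' f'' T' :=
  hf ▸ h.mono hT

theorem seq (h : Exec p v f v' f' T) (h' : Exec q v' f' v'' f'' T') :
    Exec (.seq p q) v f v'' f'' (T + T') :=
  let ⟨t, ht, r⟩ := h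
  let ⟨t', ht', r'⟩ := h'
  ⟨t + t', add_le_add ht ht', .seq r r'⟩

theorem load {g : Option Sym → Option Sym} : Exec (.load g) v f (g v) f 1 :=
  ⟨1, le_rfl, .load⟩

theorem cond_true {c} (hc : c v = true) (h : Exec p v f v' f' T) :
    Exec (.cond c p q) v f v' f' (T + 1) :=
  let ⟨t, ht, r⟩ := h
  ⟨t + 1, by omega, .cond_true hc r⟩

theorem cond_false {c} (hc : c v = false) (h : Exec q v f v' f' T) :
    Exec (.cond c p q) v f v' f' (T + 1) :=
  let ⟨t, ht, r⟩ := h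
  ⟨t + 1, by omega, .cond_false hc r⟩

theorem loop_false {c} (hc : c v = false) : Exec (.loop c p) v f v f 1 :=
  ⟨1, le_rfl, .loop_false hc⟩

theorem loop_true {c} (hc : c v = true) (h : Exec p v f v' f' T)
    (h' : Exec (.loop c p) v' f' v'' f'' T') : Exec (.loop c p) v f v'' f'' (T + T' + 1) :=
  let ⟨t, ht, r⟩ := h
  let ⟨t', ht', r'⟩ := h'
  ⟨t + t' + 1, by omega, .loop_true hc r r'⟩

end Exec

/-- Push a fixed symbol. -/
def pushSym (k : Stk) (s : Sym) : SProg := .push (some k) fun _ => s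

/-- Push the symbol in the register. (The default is never used: the register is not empty when this
instruction is reached.) -/
def pushReg (k : Stk) : SProg := .push (some k) fun v => v.getD .minus

/-- Pop a symbol into the register; the register becomes `none` if the stack is empty. -/
def popReg (k : Stk) : SProg := .pop (some k) fun _ o => o

theorem exec_pushSym {k : Stk} {s : Sym} {v f} :
    Exec (pushSym k s) v f v (Function.update f k (s :: f k)) 1 :=
  ⟨1, le_rfl, by rw [← update_stk]; exact .push⟩

theorem exec_pushReg {k : Stk} {s : Sym} {f} :
    Exec (pushReg k) (some s) f (some s) (Function.update f k (s :: f k)) 1 :=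
  ⟨1, le_rfl, by rw [← update_stk]; exact .push⟩

theorem exec_popReg {k : Stk} {v f} :
    Exec (popReg k) v f (f k).head? (Function.update f k (f k).tail) 1 :=
  ⟨1, le_rfl, by rw [← update_stk]; exact .pop⟩

/-- Push the symbol in the register on each of the given stacks. -/
def pushAll : List Stk → SProg
  | [] => .load id
  | k :: ks => .seq (pushReg k) (pushAll ks)

theorem exec_pushAll {s : Sym} (ks : List Stk) (hk : ks.Nodup) (f : Stk → List Sym) :
    Exec (pushAll ks) (some s) f (some s) (fun k => if k ∈ ks then s :: f k else f k)
      (ks.length + 1) := by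
  induction ks generalizing f with
  | nil => exact Exec.of_eq Exec.load (by simp) (by simp)
  | cons k ks ih =>
    rw [List.nodup_cons] at hk
    refine Exec.of_eq ((exec_pushReg).seq (ih hk.2 _)) ?_ (by simp; omega)
    funext k'
    by_cases h : k' = k
    · subst h; simp [hk.1]
    · simp [h]

/-- Binary trees, the data on which programs operate. -/
inductive BinTree
  | leaf
  | node (a b : BinTree)

/-- Trees in Polish notation. Since this is a prefix code, the end of a tree can be found by reading
it, and trees can be stacked without separators. -/
def BinTree.code : BinTree → List Sym
  | leaf => [.bit false]
  | node a b => .bit true :: (a.code ++ b.code)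

theorem BinTree.one_le_length_code (d : BinTree) : 1 ≤ d.code.length := by
  cases d <;> simp [code]

theorem BinTree.minus_notMem_code (d : BinTree) : Sym.minus ∉ d.code := by
  induction d <;> simp_all [code]

/-- The loop of `move`. The minus signs on the stack `cnt` and in the register count the trees yet
to be moved: one tree is replaced by its two subtrees when a node is read, and by none when a leaf
is read. -/
def moveLoop (ks : List Stk) : SProg :=
  .loop Option.isSome (.seq (popReg .main) (.seq (pushAll ks) (.seq
    (.cond (fun v => v = some (.bit true)) (.seq (pushSym .cnt .minus) (pushSym .cnt .minus))
      (.load id)) (popReg .cnt))))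

/-- Remove a tree from the main stack and push its code, symbol by symbol, on all of the stacks
`ks`. -/
def move (ks : List Stk) : SProg :=
  .seq (pushSym .cnt .minus) (.seq (popReg .cnt) (moveLoop ks))

/-- The stacks `f`, with new contents of `main` and `cnt` and with `l` pushed on all of `ks`. -/
def moved (ks : List Stk) (f : Stk → List Sym) (R C l : List Sym) : Stk → List Sym := fun k =>
  if k = .main then R else if k = .cnt then C else if k ∈ ks then l ++ f k else f k

theorem moved_moved (ks : List Stk) (f R C l R' C' l') :
    moved ks (moved ks f R C l) R' C' l' = moved ks f R' C' (l' ++ l) := by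
  funext k
  simp only [moved]
  split_ifs <;> simp

/-- One pass of the loop reads the symbol `s`. Like `exec_moveLoop`, this is stated for an arbitrary
rest `h` of the loop, which makes the induction over trees go through. -/
theorem exec_moveLoop_step {ks : List Stk} (hk : ks.Nodup) (hm : Stk.main ∉ ks) (hc : Stk.cnt ∉ ks)
    {s s' : Sym} {f : Stk → List Sym} {R C : List Sym} (hf : f .main = s :: R)
    (hC : C = (if s = .bit true then [.minus, .minus] else []) ++ f .cnt) {v' f' T}
    (h : Exec (moveLoop ks) C.head? (moved ks f R C.tail [s]) v' f' T) :
    Exec (moveLoop ks) (some s') f v' f' (T + (ks.length + 7)) := by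
  have h1 : Exec (popReg .main) (some s') f (some s) (Function.update f .main R) 1 := by
    simpa [hf] using exec_popReg (k := .main) (v := some s') (f := f)
  have h2 := exec_pushAll (s := s) ks hk (Function.update f .main R)
  set g : Stk → List Sym := fun k =>
    if k ∈ ks then s :: Function.update f .main R k else Function.update f .main R k with hg
  have hgc : g .cnt = f .cnt := by simp [hg, hc]
  have h3 : Exec (.cond (fun v => v = some (.bit true))
      (.seq (pushSym .cnt .minus) (pushSym .cnt .minus)) (.load id)) (some s) g (some s)
      (Function.update g .cnt C) 3 := by
    by_cases hs : s = .bit true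
    · refine Exec.cond_true (T := 2) (by simp [hs]) ?_
      have := (exec_pushSym (k := .cnt) (s := .minus) (v := some s) (f := g)).seq
        (exec_pushSym (k := .cnt) (s := .minus))
      simpa [hC, hs, hgc] using this
    · refine (Exec.cond_false (T := 1) (by simp [hs]) ?_).mono (by omega)
      have : Function.update g .cnt C = g := by
        rw [Function.update_eq_self_iff, hC, hgc]; simp [hs]
      rw [this]
      exact Exec.load (g := id)
  have h4 := exec_popReg (k := .cnt) (v := some s) (f := Function.update g .cnt C)
  rw [Function.update_self, Function.update_idem] at h4
  have he : Function.update g .cnt C.tail = moved ks f R C.tail [s] := by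
    funext k
    by_cases h1 : k = .main
    · subst h1; simp [moved, hg, hm]
    by_cases h2 : k = .cnt
    · subst h2; simp [moved]
    simp [moved, hg, h1, h2]
  rw [he] at h4
  exact (Exec.loop_true rfl (h1.seq (h2.seq (h3.seq h4))) h).mono (by omega)

/-- The loop moves the tree `d`, and then goes on with the next pending tree. -/
theorem exec_moveLoop {ks : List Stk} (hk : ks.Nodup) (hm : Stk.main ∉ ks) (hc : Stk.cnt ∉ ks)
    {v' f'} (d : BinTree) : ∀ {s' : Sym} {f : Stk → List Sym} {R : List Sym} {T},
    f .main = d.code ++ R →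
    Exec (moveLoop ks) (f .cnt).head? (moved ks f R (f .cnt).tail d.code.reverse) v' f' T →
    Exec (moveLoop ks) (some s') f v' f' (T + (ks.length + 7) * d.code.length) := by
  induction d with
  | leaf =>
    intro s' f R T hf h
    refine (exec_moveLoop_step hk hm hc hf (C := f .cnt) (by simp) h).mono ?_
    simp [BinTree.code]
  | node a b iha ihb =>
    intro s' f R T hf h
    simp only [BinTree.code, List.cons_append, List.append_assoc] at hf
    refine (exec_moveLoop_step hk hm hc hf (C := .minus :: .minus :: f .cnt) (by simp)
      (iha (R := b.code ++ R) (by simp [moved]) (T := T + (ks.length + 7) * b.code.length)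
        ?_)).mono ?_
    · have : (moved ks f (a.code ++ (b.code ++ R))
        (Sym.minus :: Sym.minus :: f Stk.cnt).tail [Sym.bit true] Stk.cnt) = .minus :: f .cnt := by
        simp [moved]
      rw [this, moved_moved]
      refine ihb (R := R) (by simp [moved]) ?_
      rw [moved_moved]
      simpa [moved, BinTree.code] using h
    · simp [BinTree.code]; ring_nf; omega

theorem exec_move {ks : List Stk} (hk : ks.Nodup) (hm : Stk.main ∉ ks) (hc : Stk.cnt ∉ ks)
    (d : BinTree) {f : Stk → List Sym} {R : List Sym} {v}
    (hf : f .main = d.code ++ R) (h0 : f .cnt = []) :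
    Exec (move ks) v f none (moved ks f R [] d.code.reverse)
      ((ks.length + 7) * d.code.length + 3) := by
  have h1 := (exec_pushSym (k := .cnt) (s := .minus) (v := v) (f := f))
  have h2 := exec_popReg (k := .cnt) (v := v) (f := Function.update f .cnt [.minus])
  simp only [h0] at h1
  simp only [Function.update_self, Function.update_idem, List.tail_cons, List.head?_cons] at h2
  rw [show Function.update f Stk.cnt [] = f by rw [Function.update_eq_self_iff, h0]] at h2
  refine (h1.seq (h2.seq (exec_moveLoop hk hm hc d hf (T := 1) ?_))).mono (by omega)
  rw [h0]
  exact Exec.loop_false rfl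

/-- The loop of `pour`. -/
def pourLoop (src dst : Stk) : SProg :=
  .loop (fun v => v.isSome && v != some .minus) (.seq (pushReg dst) (popReg src))

/-- Pop symbols from `src` and push them on `dst`, until `src` is empty or a minus sign has been
popped. -/
def pour (src dst : Stk) : SProg :=
  .seq (popReg src) (.seq (pourLoop src dst) (.load fun _ => none))

/-- Only the symbols `l` above the first minus sign are moved; the minus sign itself is dropped. -/
theorem exec_pour {src dst : Stk} (hne : src ≠ dst) {v} {l R : List Sym} (hl : Sym.minus ∉ l)
    (hR : ∀ s ∈ R.head?, s = Sym.minus) {f : Stk → List Sym} (hf : f src = l ++ R) :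
    Exec (pour src dst) v f none
      (Function.update (Function.update f src R.tail) dst (l.reverse ++ f dst))
      (3 * l.length + 3) := by
  have key : ∀ (l : List Sym) (f : Stk → List Sym), Sym.minus ∉ l → f src = (l ++ R).tail →
      Exec (pourLoop src dst) (l ++ R).head? f R.head?
      (Function.update (Function.update f src R.tail) dst (l.reverse ++ f dst))
      (3 * l.length + 1) := by
    intro l
    induction l with
    | nil =>
      intro f _ hf
      have : (Function.update (Function.update f src R.tail) dst ([].reverse ++ f dst)) = f := by
        funext k
        by_cases h : k = dst
        · subst h; simp
        by_cases h' : k = src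
        · subst h'; simpa [h] using hf.symm
        simp [h, h']
      rw [this]
      refine Exec.loop_false ?_
      cases hR' : R.head? with
      | none => simp [hR']
      | some s => simp [hR', hR s (by simp [hR'])]
    | cons s l ih =>
      intro f hs hf
      simp only [List.mem_cons, not_or] at hs
      simp only [List.cons_append, List.tail_cons] at hf
      have h1 := exec_pushReg (k := dst) (s := s) (f := f)
      have h2 := exec_popReg (k := src) (v := some s) (f := Function.update f dst (s :: f dst))
      rw [Function.update_of_ne hne, hf] at h2
      have h3 := ih (Function.update (Function.update f dst (s :: f dst)) src (l ++ R).tail) hs.2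
        (by simp)
      refine Exec.of_eq (Exec.loop_true (by simpa using Ne.symm hs.1) (h1.seq h2) h3) ?_
        (by simp; omega)
      funext k
      by_cases h : k = dst
      · subst h; simp [Function.update_of_ne hne.symm]
      by_cases h' : k = src
      · subst h'; simp [h]
      simp [h, h']
  have h1 := exec_popReg (k := src) (v := v) (f := f)
  rw [hf] at h1
  have h2 := key l (Function.update f src (l ++ R).tail) hl (by simp)
  refine Exec.of_eq (h1.seq (h2.seq (Exec.load (g := fun _ => none)))) ?_ (by omega)
  funext k
  by_cases h : k = dst
  · subst h; simp [Function.update_of_ne hne.symm]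
  by_cases h' : k = src
  · subst h'; simp [h]
  simp [h, h']

/-- The stack contents between two operations on trees: only `main` and `store` are in use. -/
def base (M X : List Sym) : Stk → List Sym
  | .main => M
  | .store => X
  | _ => []

/-- Remove the tree on top of the main stack. -/
def dropTree : SProg := move []

theorem exec_dropTree (d : BinTree) (M X : List Sym) :
    Exec dropTree none (base (d.code ++ M) X) none (base M X) (7 * d.code.length + 3) := by
  refine Exec.of_eq (exec_move (ks := []) (by simp) (by simp) (by simp) d (R := M) rfl rfl) ?_
    (by simp)
  funext k
  cases k <;> simp [moved, base]

/-- Duplicate the tree on top of the main stack. -/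
def dupTree : SProg :=
  .seq (move [.tmp₁, .tmp₂]) (.seq (pour .tmp₁ .main) (pour .tmp₂ .main))

theorem exec_dupTree (d : BinTree) (M X : List Sym) :
    Exec dupTree none (base (d.code ++ M) X) none (base (d.code ++ (d.code ++ M)) X)
      (15 * d.code.length + 9) := by
  have hd : Sym.minus ∉ d.code.reverse := by simpa using d.minus_notMem_code
  refine Exec.of_eq ((exec_move (ks := [.tmp₁, .tmp₂]) (by simp) (by simp) (by simp) d (R := M)
    rfl rfl).seq ((exec_pour (by simp) hd (R := []) (by simp) ?_).seq
      (exec_pour (by simp) hd (R := []) (by simp) ?_))) ?_ (by simp; omega)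
  · simp [moved, base]
  · simp [moved, base]
  funext k
  cases k <;> simp [moved, base, Function.update]

/-- Exchange the two trees on top of the main stack. -/
def swapTree : SProg :=
  .seq (move [.tmp₁]) (.seq (move [.tmp₂]) (.seq (pour .tmp₁ .main) (pour .tmp₂ .main)))

theorem exec_swapTree (d e : BinTree) (M X : List Sym) :
    Exec swapTree none (base (d.code ++ (e.code ++ M)) X) none (base (e.code ++ (d.code ++ M)) X)
      (11 * d.code.length + 11 * e.code.length + 12) := by
  have hd : Sym.minus ∉ d.code.reverse := by simpa using d.minus_notMem_code
  have he : Sym.minus ∉ e.code.reverse := by simpa using e.minus_notMem_code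
  refine Exec.of_eq ((exec_move (ks := [.tmp₁]) (by simp) (by simp) (by simp) d (R := e.code ++ M)
    rfl rfl).seq ((exec_move (ks := [.tmp₂]) (by simp) (by simp) (by simp) e (R := M) ?_ ?_).seq
    ((exec_pour (by simp) hd (R := []) (by simp) ?_).seq
      (exec_pour (by simp) he (R := []) (by simp) ?_)))) ?_ (by simp; omega)
  · simp [moved]
  · simp [moved]
  · simp [moved, base]
  · simp [moved, base]
  funext k
  cases k <;> simp [moved, base, Function.update]

/-- Put the tree on top of the main stack into the store, above a minus sign that marks its end. -/
def saveTree : SProg := .seq (pushSym .store .minus) (move [.store])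

/-- Undo `saveTree`. -/
def restoreTree : SProg := pour .store .main

theorem exec_saveTree (d : BinTree) (M X : List Sym) :
    Exec saveTree none (base (d.code ++ M) X) none (base M (d.code.reverse ++ .minus :: X))
      (8 * d.code.length + 4) := by
  refine Exec.of_eq ((exec_pushSym).seq
    (exec_move (ks := [.store]) (by simp) (by simp) (by simp) d (R := M) ?_ ?_)) ?_ (by simp; omega)
  · simp [base]
  · simp [base]
  funext k
  cases k <;> simp [moved, base, Function.update]

theorem exec_restoreTree (d : BinTree) (M X : List Sym) :
    Exec restoreTree none (base M (d.code.reverse ++ .minus :: X)) none (base (d.code ++ M) X)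
      (3 * d.code.length + 3) := by
  refine Exec.of_eq (exec_pour (src := .store) (by simp) (l := d.code.reverse) (R := .minus :: X)
    (by simpa using d.minus_notMem_code) (by simp) rfl) ?_ (by simp)
  funext k
  cases k <;> simp [base, Function.update]

theorem exec_popMain (s : Sym) (M X : List Sym) (v) :
    Exec (popReg .main) v (base (s :: M) X) (some s) (base M X) 1 := by
  refine Exec.of_eq (exec_popReg) ?_ le_rfl
  funext k
  cases k <;> simp [base, Function.update]

theorem exec_pushMain (s : Sym) (M X : List Sym) (v) :
    Exec (pushSym .main s) v (base M X) v (base (s :: M) X) 1 := by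
  refine Exec.of_eq (exec_pushSym) ?_ le_rfl
  funext k
  cases k <;> simp [base, Function.update]

/-- Push a fixed word on the main stack. -/
def pushWord : List Sym → SProg
  | [] => .load id
  | s :: l => .seq (pushWord l) (pushSym .main s)

theorem exec_pushWord (l M X : List Sym) (v) :
    Exec (pushWord l) v (base M X) v (base (l ++ M) X) (l.length + 1) := by
  induction l with
  | nil => exact Exec.load (g := id)
  | cons s l ih => exact (ih.seq (exec_pushMain s _ X v)).mono (by simp)

/-! ### Polynomial-time functions on encoded data -/

/-- Types whose elements are represented by binary trees. -/
class Enc (α : Type) where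
  /-- the tree that represents an element -/
  tree : α → BinTree

variable {α β γ σ : Type} [Enc α] [Enc β] [Enc γ] [Enc σ]

/-- The word that represents `a` on a stack. -/
def word (a : α) : List Sym := (Enc.tree a).code

/-- The length of the word that represents `a`. -/
def sz (a : α) : ℕ := (word a).length

instance : Enc Unit := ⟨fun _ => .leaf⟩

instance : Enc Bool := ⟨fun b => if b then .node .leaf .leaf else .leaf⟩

/-- The tree of a natural number: unary notation, as a list of leaves. -/
def natTree : ℕ → BinTree
  | 0 => .leaf
  | n + 1 => .node .leaf (natTree n)

instance : Enc ℕ := ⟨natTree⟩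

/-- The tree of a list. -/
def listTree : List α → BinTree
  | [] => .leaf
  | a :: l => .node (Enc.tree a) (listTree l)

instance : Enc (List α) := ⟨listTree⟩

instance : Enc (α × β) := ⟨fun p => .node (Enc.tree p.1) (Enc.tree p.2)⟩

theorem word_pair (a : α) (b : β) : word (a, b) = .bit true :: (word a ++ word b) := rfl
theorem word_nil : word ([] : List α) = [.bit false] := rfl
theorem word_cons (a : α) (l : List α) : word (a :: l) = .bit true :: (word a ++ word l) := rfl
theorem word_succ (n : ℕ) : word (n + 1) = .bit true :: .bit false :: word n := rfl

theorem word_pair_append (a : α) (b : β) (M : List Sym) :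
    word (a, b) ++ M = .bit true :: (word a ++ (word b ++ M)) := by simp [word_pair]
theorem word_cons_append (a : α) (l : List α) (M : List Sym) :
    word (a :: l) ++ M = .bit true :: (word a ++ (word l ++ M)) := by simp [word_cons]

theorem sz_pair (a : α) (b : β) : sz (a, b) = sz a + sz b + 1 := by simp [sz, word_pair]
theorem sz_nil : sz ([] : List α) = 1 := rfl
theorem sz_cons (a : α) (l : List α) : sz (a :: l) = sz a + sz l + 1 := by simp [sz, word_cons]
theorem sz_nat (n : ℕ) : sz n = 2 * n + 1 := by
  induction n with
  | zero => rfl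
  | succ n ih => simp only [sz, word_succ, List.length_cons] at ih ⊢; omega

theorem one_le_sz (a : α) : 1 ≤ sz a := BinTree.one_le_length_code _

theorem sz_mem_le {a : α} {l : List α} (h : a ∈ l) : sz a ≤ sz l := by
  induction l with
  | nil => simp at h
  | cons b l ih =>
    rw [sz_cons]
    rcases List.mem_cons.1 h with rfl | h
    · omega
    · have := ih h; omega

theorem length_le_sz (l : List α) : l.length ≤ sz l := by
  induction l with
  | nil => simp
  | cons b l ih => rw [sz_cons, List.length_cons]; omega

theorem sz_list_le {l : List α} {B : ℕ} (h : ∀ a ∈ l, sz a ≤ B) :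
    sz l ≤ l.length * (B + 1) + 1 := by
  induction l with
  | nil => simp [sz_nil]
  | cons b l ih =>
    rw [sz_cons, List.length_cons, Nat.add_mul]
    have h1 := ih fun a ha => h a (List.mem_cons_of_mem _ ha)
    have h2 := h b List.mem_cons_self
    omega

theorem sz_sublist_le {l l' : List α} (h : l.Sublist l') : sz l ≤ sz l' := by
  induction h with
  | slnil => exact le_rfl
  | cons a _ ih => rw [sz_cons]; omega
  | cons_cons a _ ih => rw [sz_cons, sz_cons]; omega

theorem eval_mono (p : Polynomial ℕ) {m n : ℕ} (h : m ≤ n) : p.eval m ≤ p.eval n := by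
  simp only [Polynomial.eval_eq_sum, Polynomial.sum]
  gcongr

/-- `t` is bounded by a polynomial in the size of its argument. -/
def PB (t : α → ℕ) : Prop := ∃ p : Polynomial ℕ, ∀ a, t a ≤ p.eval (sz a)

namespace PB

variable {t t' : α → ℕ}

theorem mono (h : PB t) (hle : ∀ a, t' a ≤ t a) : PB t' :=
  let ⟨p, hp⟩ := h
  ⟨p, fun a => (hle a).trans (hp a)⟩

theorem const (c : ℕ) : PB fun _ : α => c := ⟨.C c, fun a => by simp⟩

theorem size : PB fun a : α => sz a := ⟨.X, fun a => by simp⟩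

theorem add (h : PB t) (h' : PB t') : PB fun a => t a + t' a :=
  let ⟨p, hp⟩ := h
  let ⟨q, hq⟩ := h'
  ⟨p + q, fun a => by simpa using add_le_add (hp a) (hq a)⟩

theorem mul (h : PB t) (h' : PB t') : PB fun a => t a * t' a :=
  let ⟨p, hp⟩ := h
  let ⟨q, hq⟩ := h'
  ⟨p * q, fun a => by simpa using Nat.mul_le_mul (hp a) (hq a)⟩

theorem eval (p : Polynomial ℕ) (h : PB t) : PB fun a => p.eval (t a) :=
  let ⟨q, hq⟩ := h
  ⟨p.comp q, fun a => by rw [Polynomial.eval_comp]; exact eval_mono p (hq a)⟩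

/-- A polynomial bound in the size of one argument of polynomially bounded size. -/
theorem comp_of_size {t : β → ℕ} (h : PB t) {f : α → β} (hf : PB fun a => sz (f a)) :
    PB fun a => t (f a) :=
  let ⟨p, hp⟩ := h
  (hf.eval p).mono fun a => hp (f a)

end PB

/-- `f` is a polynomial-time function: some program replaces the word of `a` on top of the main
stack by the word of `f a` and leaves everything below untouched, within polynomially many steps. -/
def PF (f : α → β) : Prop :=
  ∃ (P : SProg) (p : Polynomial ℕ), ∀ a M X,
    Exec P none (base (word a ++ M) X) none (base (word (f a) ++ M) X) (p.eval (sz a))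

theorem PF.of_exec {f : α → β} {P : SProg} {T : α → ℕ} (hT : PB T)
    (h : ∀ a M X, Exec P none (base (word a ++ M) X) none (base (word (f a) ++ M) X) (T a)) :
    PF f :=
  let ⟨p, hp⟩ := hT
  ⟨P, p, fun a M X => (h a M X).mono (hp a)⟩

/-- A program that runs in polynomial time produces a result of polynomial size. -/
theorem PF.size {f : α → β} (h : PF f) : PB fun a => sz (f a) := by
  obtain ⟨P, p, hp⟩ := h
  refine ⟨.X + p, fun a => ?_⟩
  obtain ⟨t, ht, r⟩ := hp a [] []
  have := r.length_le (some .main)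
  simp only [stk, base, List.append_nil] at this
  simp only [Polynomial.eval_add, Polynomial.eval_X]
  exact this.trans (Nat.add_le_add_left ht _)

theorem PB.comp {t : β → ℕ} (h : PB t) {f : α → β} (hf : PF f) : PB fun a => t (f a) :=
  h.comp_of_size hf.size

namespace PF

theorem id : PF fun a : α => a :=
  of_exec (PB.const 1) fun _ _ _ => Exec.load (g := fun v => v)

/-- A function that does not change the representation. -/
theorem of_word_eq {f : α → β} (h : ∀ a, word (f a) = word a) : PF f :=
  of_exec (PB.const 1) fun a _ _ => by rw [h a]; exact Exec.load (g := fun v => v)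

theorem comp {g : β → γ} {f : α → β} (hg : PF g) (hf : PF f) : PF fun a => g (f a) := by
  obtain ⟨Q, q, hq⟩ := hg
  obtain ⟨P, p, hp⟩ := hf
  exact of_exec (((PB.size).eval p).add (((PF.size ⟨P, p, hp⟩).eval q)))
    fun a M X => (hp a M X).seq (hq (f a) M X)

theorem const (c : β) : PF fun _ : α => c :=
  of_exec (((PB.size.mul (PB.const 7)).add (PB.const 3)).add (PB.const (sz c + 1))) fun a M X =>
    ((exec_dropTree (Enc.tree a) M X).seq (exec_pushWord (word c) M X none)).mono
      (by simp [sz, word]; omega)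

theorem pair {f : α → β} {g : α → γ} (hf : PF f) (hg : PF g) : PF fun a => (f a, g a) := by
  have hfs := hf.size
  have hgs := hg.size
  obtain ⟨P, p, hp⟩ := hf
  obtain ⟨Q, q, hq⟩ := hg
  refine of_exec
    (P := .seq dupTree (.seq Q (.seq swapTree (.seq P (pushSym .main (.bit true))))))
    ((((PB.size.mul (PB.const 15)).add (PB.const 9)).add ((PB.size.eval q).add
    ((((PB.const 11).mul hgs).add ((PB.const 11).mul PB.size)).add (PB.const 12)))).add
    ((PB.size.eval p).add (PB.const 1))) fun a M X => ?_
  refine ((exec_dupTree (Enc.tree a) M X).seq ((hq a (word a ++ M) X).seq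
    ((exec_swapTree (Enc.tree (g a)) (Enc.tree a) M X).seq
    ((hp a (word (g a) ++ M) X).seq (exec_pushMain (.bit true) _ X none))))).of_eq ?_ ?_
  · rw [word_pair]; simp
  · simp only [sz, word]; omega

theorem fst : PF fun p : α × β => p.1 :=
  of_exec (P := .seq (popReg .main) (.seq (.load fun _ => none) (.seq swapTree dropTree)))
    (((PB.const 18).mul PB.size).add (PB.const 17)) fun p M X => by
    obtain ⟨a, b⟩ := p
    rw [word_pair_append]
    refine ((exec_popMain (.bit true) (word a ++ (word b ++ M)) X none).seq
      ((Exec.load (g := fun _ => none)).seq ((exec_swapTree (Enc.tree a) (Enc.tree b) M X).seq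
      (exec_dropTree (Enc.tree b) (word a ++ M) X)))).mono ?_
    rw [sz_pair]; simp only [sz, word]; omega

theorem snd : PF fun p : α × β => p.2 :=
  of_exec (P := .seq (popReg .main) (.seq (.load fun _ => none) dropTree))
    (((PB.const 7).mul PB.size).add (PB.const 5)) fun p M X => by
    obtain ⟨a, b⟩ := p
    rw [word_pair_append]
    refine ((exec_popMain (.bit true) (word a ++ (word b ++ M)) X none).seq
      ((Exec.load (g := fun _ => none)).seq (exec_dropTree (Enc.tree a) (word b ++ M) X))).mono ?_
    rw [sz_pair]; simp only [sz, word]; omega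

theorem cons {f : α → β} {l : α → List β} (hf : PF f) (hl : PF l) : PF fun a => f a :: l a :=
  (of_word_eq (f := fun p : β × List β => p.1 :: p.2) fun _ => rfl).comp (hf.pair hl)

/-- The head of a list, with a default value: the first symbol of the word of a list tells whether
the list is empty. -/
theorem headD {l : α → List β} (hl : PF l) (d : β) : PF fun a => (l a).headD d := by
  refine PF.comp (g := fun l : List β => l.headD d) ?_ hl
  refine of_exec (P := .seq (popReg .main) (.cond (fun v => v = some (.bit true))
      (.seq (.load fun _ => none) (.seq swapTree dropTree))
      (.seq (.load fun _ => none) (pushWord (word d)))))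
    (((PB.const 18).mul PB.size).add (PB.const (18 + sz d))) fun l M X => ?_
  cases l with
  | nil =>
    exact ((exec_popMain (.bit false) M X none).seq (Exec.cond_false (by decide)
      ((Exec.load (g := fun _ => none)).seq (exec_pushWord (word d) M X none)))).mono
      (by simp only [sz]; omega)
  | cons a l =>
    rw [word_cons_append]
    refine ((exec_popMain (.bit true) (word a ++ (word l ++ M)) X none).seq
      (Exec.cond_true (by decide) ((Exec.load (g := fun _ => none)).seq
      ((exec_swapTree (Enc.tree a) (Enc.tree l) M X).seq
      (exec_dropTree (Enc.tree l) (word a ++ M) X))))).mono ?_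
    rw [sz_cons]; simp only [sz, word]; omega

theorem tail {l : α → List β} (hl : PF l) : PF fun a => (l a).tail := by
  refine PF.comp (g := fun l : List β => l.tail) ?_ hl
  refine of_exec (P := .seq (popReg .main) (.cond (fun v => v = some (.bit true))
      (.seq (.load fun _ => none) dropTree)
      (.seq (.load fun _ => none) (pushSym .main (.bit false)))))
    (((PB.const 7).mul PB.size).add (PB.const 18)) fun l M X => ?_
  cases l with
  | nil =>
    exact ((exec_popMain (.bit false) M X none).seq (Exec.cond_false (by decide)
      ((Exec.load (g := fun _ => none)).seq (exec_pushMain (.bit false) M X none)))).mono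
      (by omega)
  | cons a l =>
    rw [word_cons_append]
    refine ((exec_popMain (.bit true) (word a ++ (word l ++ M)) X none).seq
      (Exec.cond_true (by decide) ((Exec.load (g := fun _ => none)).seq
      (exec_dropTree (Enc.tree a) (word l ++ M) X)))).mono ?_
    rw [sz_cons]; simp only [sz, word]; omega

theorem ite {c : α → Bool} {f g : α → β} (hc : PF c) (hf : PF f) (hg : PF g) :
    PF fun a => if c a then f a else g a := by
  obtain ⟨C, r, hr⟩ := hc
  obtain ⟨P, p, hp⟩ := hf
  obtain ⟨Q, q, hq⟩ := hg
  refine of_exec (P := .seq dupTree (.seq C (.seq (popReg .main)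
      (.cond (fun v => v = some (.bit true))
      (.seq (popReg .main) (.seq (popReg .main) (.seq (.load fun _ => none) P)))
      (.seq (.load fun _ => none) Q)))))
    ((((PB.const 15).mul PB.size).add ((PB.size.eval r).add (PB.const 20))).add
      ((PB.size.eval p).add (PB.size.eval q))) fun a M X => ?_
  cases hca : c a with
  | true =>
    refine ((exec_dupTree (Enc.tree a) M X).seq ((hr a (word a ++ M) X).seq
      (Exec.seq (v' := some (.bit true)) (f' := base (.bit false :: .bit false :: (word a ++ M)) X)
      (T := 1) ?_
      (Exec.cond_true (by decide) ((exec_popMain _ _ X _).seq ((exec_popMain _ _ X _).seq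
      ((Exec.load (g := fun _ => none)).seq (hp a M X)))))))).mono ?_
    · rw [hca]; exact exec_popMain _ _ X _
    · simp only [sz, word]; omega
  | false =>
    refine ((exec_dupTree (Enc.tree a) M X).seq ((hr a (word a ++ M) X).seq
      (Exec.seq (v' := some (.bit false)) (f' := base (word a ++ M) X) (T := 1) ?_
      (Exec.cond_false (by decide) ((Exec.load (g := fun _ => none)).seq (hq a M X)))))).mono ?_
    · rw [hca]; exact exec_popMain _ _ X _
    · simp only [sz, word]; omega

/-- The loop of `PF.iterate`: a list lies above the current value on the main stack, and its first
symbol is in the register. The head of the list is dropped, and its tail is kept in the store while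
`P` is applied to the value. -/
def iterLoop (P : SProg) : SProg :=
  .loop (fun v => v = some (.bit true)) (.seq (.load fun _ => none) (.seq dropTree (.seq saveTree
    (.seq P (.seq restoreTree (popReg .main))))))

theorem exec_iterLoop {f : σ → σ} {P : SProg} {p : Polynomial ℕ} (hp : ∀ a M X,
    Exec P none (base (word a ++ M) X) none (base (word (f a) ++ M) X) (p.eval (sz a)))
    (M X : List Sym) {B : ℕ} (l : List β) : ∀ s : σ, (∀ i ≤ l.length, sz (f^[i] s) ≤ B) →
    Exec (iterLoop P) (word l).head? (base ((word l).tail ++ (word s ++ M)) X) (some (.bit false))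
      (base (word (f^[l.length] s) ++ M) X) (l.length * (p.eval B + 11 * sz l + 13) + 1) := by
  induction l with
  | nil =>
    intro s _
    exact (Exec.loop_false (by simp [word_nil])).mono (by omega)
  | cons x l ih =>
    intro s hB
    have h1 := ih (f s) fun i hi => by
      simpa [Function.iterate_succ_apply] using hB (i + 1) (by simpa using hi)
    have h2 : sz s ≤ B := by simpa using hB 0 (by simp)
    obtain ⟨c, w, hw⟩ : ∃ c w, word l = c :: w := by
      cases hl : word l with
      | nil => have := one_le_sz l; simp [sz, hl] at this
      | cons c w => exact ⟨c, w, rfl⟩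
    have h3 := exec_popMain c (w ++ (word (f s) ++ M)) X none
    rw [hw] at h1
    have hm : word l ++ (word (f s) ++ M) = c :: (w ++ (word (f s) ++ M)) := by rw [hw]; rfl
    have h4 := exec_restoreTree (Enc.tree l) (word (f s) ++ M) X
    rw [show (Enc.tree l).code = word l from rfl, hm] at h4
    have ht : (word (x :: l)).tail ++ (word s ++ M) = word x ++ (word l ++ (word s ++ M)) := by
      simp [word_cons]
    rw [ht]
    refine (Exec.loop_true (by simp [word_cons])
      ((Exec.load (g := fun _ => none)).seq ((exec_dropTree (Enc.tree x) _ X).seq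
      ((exec_saveTree (Enc.tree l) (word s ++ M) X).seq ((hp s M _).seq
      (h4.seq h3))))) h1).mono ?_
    have h5 := eval_mono p h2
    have h6 : l.length * (p.eval B + 11 * sz l + 13) ≤
        l.length * (p.eval B + 11 * sz (x :: l) + 13) := by
      rw [sz_cons]; gcongr; omega
    rw [List.length_cons, Nat.add_mul, sz_cons] at *
    simp only [sz, word] at *
    omega

/-- Iteration, as many times as a list has elements. The polynomial bound on the size of all
intermediate results is indispensable: repeated doubling of the size would be exponential. -/
theorem iterate {f : σ → σ} (hf : PF f) {l : α → List β} (hl : PF l) {s : α → σ} (hs : PF s)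
    {B : α → ℕ} (hB : PB B) (h : ∀ a, ∀ i ≤ (l a).length, sz (f^[i] (s a)) ≤ B a) :
    PF fun a => f^[(l a).length] (s a) := by
  have hls := hl.size
  have hpair := hl.pair hs
  obtain ⟨P, p, hp⟩ := hf
  obtain ⟨Q, q, hq⟩ := hpair
  refine of_exec (P := .seq Q (.seq (popReg .main) (.seq (popReg .main) (.seq (iterLoop P)
    (.load fun _ => none)))))
    (((PB.size.eval q).add (PB.const 4)).add
      (hls.mul (((hB.eval p).add ((PB.const 11).mul hls)).add (PB.const 13)))) fun a M X => ?_
  obtain ⟨c, w, hw⟩ : ∃ c w, word (l a) = c :: w := by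
    cases hl : word (l a) with
    | nil => have := one_le_sz (l a); simp [sz, hl] at this
    | cons c w => exact ⟨c, w, rfl⟩
  have h1 := hq a M X
  have h2 := exec_iterLoop hp M X (l a) (s a) (h a)
  rw [word_pair_append, hw] at h1
  rw [hw] at h2
  refine (h1.seq ((exec_popMain _ _ X _).seq ((exec_popMain _ _ X _).seq (h2.seq
    (Exec.load (g := fun _ => none)))))).mono ?_
  have := Nat.mul_le_mul_right (p.eval (B a) + 11 * sz (l a) + 13) (length_le_sz (l a))
  omega

end PF

/-! ### A library of polynomial-time functions -/

theorem sz_append (l l' : List α) : sz (l ++ l') + 1 = sz l + sz l' := by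
  induction l with
  | nil => simp [sz_nil]; omega
  | cons a l ih => rw [List.cons_append, sz_cons, sz_cons]; omega

theorem sz_reverse (l : List α) : sz l.reverse = sz l := by
  induction l with
  | nil => rfl
  | cons a l ih =>
    have := sz_append l.reverse [a]
    rw [List.reverse_cons, sz_cons]
    rw [sz_cons, sz_nil] at this
    omega

theorem sz_bool_le (b : Bool) : sz b ≤ 3 := by cases b <;> decide

namespace PF

theorem of_eq {f g : α → β} (hf : PF f) (h : ∀ a, f a = g a) : PF g :=
  (funext h : f = g) ▸ hf

theorem ite_prop {c : α → Prop} [DecidablePred c] {f g : α → β} (hc : PF fun a => decide (c a))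
    (hf : PF f) (hg : PF g) : PF fun a => if c a then f a else g a :=
  (hc.ite hf hg).of_eq fun a => by simp

theorem fst' {f : α → β × γ} (hf : PF f) : PF fun a => (f a).1 := PF.fst.comp hf

theorem snd' {f : α → β × γ} (hf : PF f) : PF fun a => (f a).2 := PF.snd.comp hf

theorem succ {n : α → ℕ} (hn : PF n) : PF fun a => n a + 1 :=
  (of_word_eq (f := fun p : Unit × ℕ => p.2 + 1) fun _ => rfl).comp ((PF.const ()).pair hn)

/-- Iterating the constant function `false`, starting from `true`, tests for emptiness. -/
theorem isEmpty {l : α → List β} (hl : PF l) : PF fun a => (l a).isEmpty := by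
  refine (iterate (PF.const (α := Bool) false) hl (PF.const true) (PB.const 3)
    fun _ _ _ => sz_bool_le _).of_eq fun a => ?_
  cases h : l a with
  | nil => rfl
  | cons x t => rw [List.length_cons, Function.iterate_succ_apply']; rfl

theorem length {l : α → List β} (hl : PF l) : PF fun a => (l a).length := by
  have key : ∀ i n : ℕ, (fun n => n + 1)^[i] n = n + i := fun i => by
    induction i with
    | zero => simp
    | succ i ih => intro n; rw [Function.iterate_succ_apply, ih]; omega
  refine (iterate (PF.id.succ) hl (PF.const 0) (((PB.const 2).mul hl.size).add (PB.const 1))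
    fun a i hi => ?_).of_eq fun a => ?_
  · rw [key, sz_nat]; have := length_le_sz (l a); omega
  · rw [key]; simp

/-- A natural number has the same representation as a list of units. -/
theorem replicate_unit {n : α → ℕ} (hn : PF n) : PF fun a => List.replicate (n a) () := by
  refine (of_word_eq (f := fun n : ℕ => List.replicate n ()) fun n => ?_).comp hn
  induction n with
  | zero => rfl
  | succ n ih => rw [List.replicate_succ, word_cons, ih]; rfl

theorem iterate_nat {f : σ → σ} (hf : PF f) {n : α → ℕ} (hn : PF n) {s : α → σ} (hs : PF s)
    {B : α → ℕ} (hB : PB B) (h : ∀ a, ∀ i ≤ n a, sz (f^[i] (s a)) ≤ B a) :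
    PF fun a => f^[n a] (s a) :=
  (iterate hf hn.replicate_unit hs hB (by simpa using h)).of_eq (by simp)

theorem eq_zero {n : α → ℕ} (hn : PF n) : PF fun a => decide (n a = 0) :=
  hn.replicate_unit.isEmpty.of_eq fun a => by cases n a <;> simp [List.replicate_succ]

theorem not {b : α → Bool} (hb : PF b) : PF fun a => !b a :=
  (hb.ite (PF.const false) (PF.const true)).of_eq fun a => by cases b a <;> rfl

theorem and {b c : α → Bool} (hb : PF b) (hc : PF c) : PF fun a => b a && c a :=
  (hb.ite hc (PF.const false)).of_eq fun a => by cases b a <;> rfl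

theorem pred {n : α → ℕ} (hn : PF n) : PF fun a => n a - 1 :=
  hn.replicate_unit.tail.length.of_eq fun a => by simp

theorem add {m n : α → ℕ} (hm : PF m) (hn : PF n) : PF fun a => m a + n a := by
  have key : ∀ i n : ℕ, (fun n => n + 1)^[i] n = n + i := fun i => by
    induction i with
    | zero => simp
    | succ i ih => intro n; rw [Function.iterate_succ_apply, ih]; omega
  refine (iterate_nat (PF.id.succ) hn hm (hm.size.add hn.size) fun a i hi => ?_).of_eq fun a => ?_
  · rw [key]; simp only [sz_nat]; omega
  · rw [key]

theorem sub {m n : α → ℕ} (hm : PF m) (hn : PF n) : PF fun a => m a - n a := by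
  have key : ∀ i n : ℕ, (fun n => n - 1)^[i] n = n - i := fun i => by
    induction i with
    | zero => simp
    | succ i ih => intro n; rw [Function.iterate_succ_apply, ih]; omega
  refine (iterate_nat (PF.id.pred) hn hm hm.size fun a i hi => ?_).of_eq fun a => ?_
  · rw [key]; simp only [sz_nat]; omega
  · rw [key]

theorem mul {m n : α → ℕ} (hm : PF m) (hn : PF n) : PF fun a => m a * n a := by
  have key : ∀ i n : ℕ, (fun p : ℕ × ℕ => (p.1, p.2 + p.1))^[i] (n, 0) = (n, i * n) :=
      fun i n => by
    induction i with
    | zero => simp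
    | succ i ih => rw [Function.iterate_succ_apply', ih]; simp [Nat.add_mul]
  refine (PF.snd.comp (iterate_nat (PF.fst.pair (PF.snd.add PF.fst)) hm (hn.pair (PF.const 0))
    (hn.size.add ((hm.size.mul hn.size).add (PB.const 1))) fun a i hi => ?_)).of_eq fun a => ?_
  · rw [key, sz_pair]
    simp only [sz_nat]
    have := Nat.mul_le_mul_right (n a) hi
    nlinarith
  · rw [key]

theorem le {m n : α → ℕ} (hm : PF m) (hn : PF n) : PF fun a => decide (m a ≤ n a) :=
  (hm.sub hn).eq_zero.of_eq fun a => by simp [Nat.sub_eq_zero_iff_le]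

theorem lt {m n : α → ℕ} (hm : PF m) (hn : PF n) : PF fun a => decide (m a < n a) :=
  hm.succ.le hn

theorem eq {m n : α → ℕ} (hm : PF m) (hn : PF n) : PF fun a => decide (m a = n a) :=
  ((hm.le hn).and (hn.le hm)).of_eq fun a => by
    rw [← Bool.decide_and, decide_eq_decide]; omega

theorem ne {m n : α → ℕ} (hm : PF m) (hn : PF n) : PF fun a => decide (m a ≠ n a) :=
  (hm.eq hn).not.of_eq fun a => by simp

theorem mod_const {n : α → ℕ} (hn : PF n) (N : ℕ) : PF fun a => n a % N := by
  rcases Nat.eq_zero_or_pos N with rfl | hN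
  · simpa using hn
  have key : ∀ i : ℕ, (fun s => if N ≤ s + 1 then 0 else s + 1)^[i] 0 = i % N := fun i => by
    induction i with
    | zero => simp
    | succ i ih =>
      have hlt := Nat.mod_lt i hN
      rw [Function.iterate_succ_apply', ih, ← Nat.mod_add_mod]
      split_ifs with h
      · rw [show i % N + 1 = N by omega, Nat.mod_self]
      · exact (Nat.mod_eq_of_lt (by omega)).symm
  refine (iterate_nat (ite_prop ((PF.const N).le PF.id.succ) (PF.const 0) PF.id.succ) hn
    (PF.const 0) (PB.const (2 * N + 1)) fun a i hi => ?_).of_eq fun a => key _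
  rw [key, sz_nat]
  have := Nat.mod_lt i hN
  omega

/-- Folding a function with context `a` over a list. The iterated function acts on the context, the
rest of the list and the current value; it is not applied after the list is used up, so that the
default head of the empty list plays no role. -/
theorem foldl [Inhabited β] {g : α → σ → β → σ} (hg : PF fun p : α × σ × β => g p.1 p.2.1 p.2.2)
    {l : α → List β} (hl : PF l) {s : α → σ} (hs : PF s) {B : α → ℕ} (hB : PB B)
    (h : ∀ a, ∀ l', l' <+: l a → sz (l'.foldl (g a) (s a)) ≤ B a) :
    PF fun a => (l a).foldl (g a) (s a) := by
  let F : α × List β × σ → α × List β × σ :=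
    fun p => (p.1, p.2.1.tail, g p.1 p.2.2 (p.2.1.headD default))
  have hF : PF F := PF.fst.pair ((PF.snd.fst').tail.pair (hg.comp
    (PF.fst.pair (PF.snd.snd'.pair ((PF.snd.fst').headD default)))))
  have key : ∀ i : ℕ, ∀ (a : α) (l : List β) (s : σ), i ≤ l.length →
      F^[i] (a, l, s) = (a, l.drop i, (l.take i).foldl (g a) s) := fun i => by
    induction i with
    | zero => simp
    | succ i ih =>
      intro a l s hi
      cases l with
      | nil => simp at hi
      | cons x l => rw [Function.iterate_succ_apply, ih _ _ _ (by simpa using hi)]; simp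
  refine ((hF.iterate hl (PF.id.pair (hl.pair hs)) (PB.size.add ((hl.size.add hB).add (PB.const 2)))
    fun a i hi => ?_).snd'.snd').of_eq fun a => ?_
  · rw [key _ _ _ _ hi, sz_pair, sz_pair]
    have := sz_sublist_le ((l a).drop_sublist i)
    have := h a _ ((l a).take_prefix i)
    omega
  · rw [key _ _ _ _ le_rfl, List.take_length]

theorem reverse [Inhabited β] {l : α → List β} (hl : PF l) : PF fun a => (l a).reverse := by
  refine (foldl (g := fun _ s b => b :: s) (PF.snd.snd'.cons PF.snd.fst') hl (PF.const [])
    hl.size fun a l' h => ?_).of_eq fun a => by simp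
  rw [show l'.foldl (fun s b => b :: s) [] = l'.reverse by simp, sz_reverse]
  exact sz_sublist_le h.sublist

end PF

/-- A quantity that is polynomial in the sizes of a context and of an element is bounded uniformly
for all elements of a list that is computed in polynomial time from the context. -/
theorem PB.of_mem {t : α × β → ℕ} (ht : PB t) {l : α → List β} (hl : PF l) :
    ∃ B : α → ℕ, PB B ∧ ∀ a, ∀ b ∈ l a, t (a, b) ≤ B a := by
  obtain ⟨p, hp⟩ := ht
  refine ⟨_, ((PB.size.add hl.size).add (PB.const 1)).eval p, fun a b hb => ?_⟩
  refine (hp _).trans (eval_mono p ?_)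
  rw [sz_pair]
  have := sz_mem_le hb
  omega

namespace PF

theorem map [Inhabited β] {g : α → β → γ} (hg : PF fun p : α × β => g p.1 p.2)
    {l : α → List β} (hl : PF l) : PF fun a => (l a).map (g a) := by
  obtain ⟨B, hB, h⟩ := PB.of_mem hg.size hl
  refine (foldl (g := fun a s b => g a b :: s) (s := fun _ => [])
    ((hg.comp (PF.fst.pair PF.snd.snd')).cons PF.snd.fst') hl.reverse (PF.const [])
    ((hl.size.mul (hB.add (PB.const 1))).add (PB.const 1)) fun a l' hl' => ?_).of_eq fun a => ?_
  · have e : ∀ (l' : List β) (s : List γ), l'.foldl (fun s b => g a b :: s) s =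
        (l'.map (g a)).reverse ++ s := fun l' => by
      induction l' with
      | nil => simp
      | cons b l' ih => intro s; simp [ih]
    rw [e]
    refine (sz_list_le (B := B a) ?_).trans ?_
    · intro c hc
      simp only [List.append_nil, List.mem_reverse, List.mem_map] at hc
      obtain ⟨b, hb, rfl⟩ := hc
      exact h a b (by simpa using hl'.subset hb)
    · have h1 := hl'.length_le
      have h2 := length_le_sz (l a)
      simp only [List.length_append, List.length_reverse, List.length_map, List.length_nil,
        add_zero] at h1 ⊢
      gcongr
      omega
  · simp only [List.foldl_reverse]
    induction l a with
    | nil => rfl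
    | cons b l' ih => simp [ih]

theorem filter [Inhabited β] {g : α → β → Bool} (hg : PF fun p : α × β => g p.1 p.2)
    {l : α → List β} (hl : PF l) : PF fun a => (l a).filter (g a) := by
  refine (foldl (g := fun a s b => if g a b then b :: s else s) (s := fun _ => [])
    ((hg.comp (PF.fst.pair PF.snd.snd')).ite (PF.snd.snd'.cons PF.snd.fst') PF.snd.fst')
    hl.reverse (PF.const []) hl.size fun a l' hl' => ?_).of_eq fun a => ?_
  · have e : ∀ (l' : List β) (s : List β), l'.foldl (fun s b => if g a b then b :: s else s) s =
        (l'.filter (g a)).reverse ++ s := fun l' => by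
      induction l' with
      | nil => simp
      | cons b l' ih => intro s; by_cases hb : g a b <;> simp [ih, hb]
    rw [e, List.append_nil]
    refine sz_sublist_le ?_
    have := (List.filter_sublist (p := g a) (l := l')).trans hl'.sublist
    simpa using this.reverse
  · simp only [List.foldl_reverse]
    induction l a with
    | nil => rfl
    | cons b l' ih => by_cases hb : g a b <;> simp [ih, hb]

theorem sum {l : α → List ℕ} (hl : PF l) : PF fun a => (l a).sum := by
  have key : ∀ l : List ℕ, sz l.sum ≤ sz l := fun l => by
    induction l with
    | nil => simp [sz_nat, sz_nil]
    | cons b l' ih => rw [List.sum_cons, sz_cons]; simp only [sz_nat] at *; omega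
  refine (foldl (g := fun _ s b => s + b) (PF.snd.fst'.add PF.snd.snd') hl (PF.const 0)
    hl.size fun a l' h => ?_).of_eq fun a => ?_
  · rw [← List.sum_eq_foldl]
    exact (key l').trans (sz_sublist_le h.sublist)
  · rw [← List.sum_eq_foldl]

theorem range {n : α → ℕ} (hn : PF n) : PF fun a => List.range (n a) := by
  have key : ∀ i : ℕ, (fun l : List ℕ => 0 :: l.map (fun x => x + 1))^[i] [] = List.range i :=
    fun i => by
    induction i with
    | zero => simp
    | succ i ih => rw [Function.iterate_succ_apply', ih, List.range_succ_eq_map]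
  refine (iterate_nat (f := fun l : List ℕ => 0 :: l.map (fun x => x + 1))
    ((PF.const 0).cons (PF.map (g := fun _ x => x + 1) PF.snd.succ PF.id)) hn (PF.const [])
    ((hn.size.mul (hn.size.add (PB.const 1))).add (PB.const 1)) fun a i hi => ?_).of_eq
    fun a => key _
  rw [key]
  refine (sz_list_le (B := sz (n a)) fun x hx => ?_).trans ?_
  · rw [List.mem_range] at hx; simp only [sz_nat]; omega
  · rw [List.length_range]
    gcongr
    rw [sz_nat]; omega

theorem getD {l : α → List β} (hl : PF l) {n : α → ℕ} (hn : PF n) (d : β) :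
    PF fun a => (l a).getD (n a) d := by
  have key : ∀ (i : ℕ) (l : List β), List.tail^[i] l = l.drop i := fun i => by
    induction i with
    | zero => simp
    | succ i ih => intro l; rw [Function.iterate_succ_apply, ih]; simp
  refine ((iterate_nat (f := List.tail) PF.id.tail hn hl hl.size fun a i _ => ?_).headD d).of_eq
    fun a => ?_
  · rw [key]; exact sz_sublist_le (List.drop_sublist _ _)
  · rw [key]; simp [List.headD_eq_head?_getD]

end PF

/-! ### The algorithm -/

/-- The entry of a matrix that is given as a list of rows; zero outside of the matrix. -/
def entry (A : List (List ℕ)) (i j : ℕ) : ℕ := (A.getD i []).getD j 0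

/-- The `m × m` matrix of the residues of `f i j` modulo `N`. -/
def tab (N m : ℕ) (f : ℕ → ℕ → ℕ) : List (List ℕ) :=
  (List.range m).map fun i => (List.range m).map fun j => f i j % N

theorem length_tab (N m : ℕ) (f) : (tab N m f).length = m := by simp [tab]

theorem entry_tab {N m : ℕ} {f : ℕ → ℕ → ℕ} {i j : ℕ} (hi : i < m) (hj : j < m) :
    entry (tab N m f) i j = f i j % N := by
  simp [entry, tab, hi, hj]

/-- The entries after `c` times row and column `w` has been added to row and column `u`, except at
the positions `(u, w)` and `(w, u)`, where the diagonal entry `(w, w)` would come in. -/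
def rowOpEntry (A : List (List ℕ)) (u w c i j : ℕ) : ℕ :=
  if i = u then if j = w then entry A i j else entry A i j + c * entry A w j
  else if j = u then if i = w then entry A i j else entry A i j + c * entry A i w
  else entry A i j

/-- Add `c` times row and column `w` to row and column `u`, modulo `N`. -/
def rowOp (N : ℕ) (A : List (List ℕ)) (u w c : ℕ) : List (List ℕ) :=
  tab N A.length (rowOpEntry A u w c)

/-- Delete a vertex. -/
def del (L : List ℕ) (x : ℕ) : List ℕ := L.filter fun y => decide (y ≠ x)

/-- The correction that accompanies a row operation; `H` evaluates the smaller hafnians. -/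
def corr (H : List (List ℕ) × List ℕ → ℕ) (A : List (List ℕ)) (T : List ℕ) (w : ℕ) : ℕ :=
  (T.map fun p => (T.map fun q =>
    if p < q then entry A w p * entry A w q * H (A, del (del T p) q) else 0).sum).sum

/-- The part of the expansion along `v` with partners in `U`; `H` evaluates the smaller hafnians. -/
def expansion (H : List (List ℕ) × List ℕ → ℕ) (A : List (List ℕ)) (T U : List ℕ) (v : ℕ) : ℕ :=
  (U.map fun x => entry A v x * H (A, del T x)).sum

/-- Make the entry `(v, u)` even by means of the odd entry `(v, w)`: the row operation with `w` and
the factor `c = entry A v u` turns it into `c + c * entry A v w`. The state consists of the matrix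
and the accumulated sum; `coef` is the factor of the hafnian that is being transformed. The
correction is subtracted, with `N - 1` in the role of `-1` modulo `N`. -/
def clearEntry (N : ℕ) (H : List (List ℕ) × List ℕ → ℕ) (L : List ℕ) (v w coef : ℕ)
    (s : List (List ℕ) × ℕ) (u : ℕ) : List (List ℕ) × ℕ :=
  (rowOp N s.1 u w (entry s.1 v u),
    (s.2 + (N - 1) * (2 * entry s.1 v u * coef * corr H s.1 (del (del L u) w) w)) % N)

/-- The states of the elimination: a matrix, the list of remaining vertices, a factor, and the sum
accumulated so far. -/
abbrev ElimState := List (List ℕ) × List ℕ × ℕ × ℕ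

/-- Elimination of the first vertex `v` when its row has an odd entry in column `w`. After all the
other entries have been made even, the terms of the expansion along `v` with partners other than `w`
are added to the sum, and the term with partner `w` becomes the new hafnian with its factor. -/
def pivotStep (N : ℕ) (H : List (List ℕ) × List ℕ → ℕ) (s : ElimState) (v w : ℕ) : ElimState :=
  let U := del s.2.1.tail w
  let r := U.foldl (clearEntry N H s.2.1 v w s.2.2.1) (s.1, s.2.2.2)
  (r.1, U, s.2.2.1 * entry r.1 v w % N,
    (r.2 + s.2.2.1 * expansion H r.1 s.2.1.tail U v) % N)

/-- The columns of the odd entries in the row of the first vertex. -/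
def oddCols (A : List (List ℕ)) (L : List ℕ) : List ℕ :=
  L.tail.filter fun x => decide (entry A (L.headD 0) x % 2 = 1)

/-- One step of the elimination: the first vertex is disposed of, together with a partner with which
it has an odd entry. If there is no such partner, then the expansion along the first vertex finishes
the computation. -/
def elimStep (N : ℕ) (H : List (List ℕ) × List ℕ → ℕ) (s : ElimState) : ElimState :=
  if s.2.1.length = 0 then s
  else if (oddCols s.1 s.2.1).length = 0 then
    (s.1, [], 0, (s.2.2.2 + s.2.2.1 * expansion H s.1 s.2.1.tail s.2.1.tail (s.2.1.headD 0)) % N)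
  else pivotStep N H s (s.2.1.headD 0) ((oddCols s.1 s.2.1).headD 0)

/-- The hafnian modulo `2 ^ k` of the submatrix given by a list of vertices. Every step of the
elimination removes a vertex as long as there is one, so the length of the list is a sufficient
number of steps; after that, the remaining hafnian is that of the empty matrix, which is `1`. -/
def hafAlgo : ℕ → List (List ℕ) × List ℕ → ℕ
  | 0, _ => 0
  | k + 1, p =>
    let s := (elimStep (2 ^ (k + 1)) (hafAlgo k))^[p.2.length] (p.1, p.2, 1, 0)
    (s.2.2.2 + s.2.2.1) % 2 ^ (k + 1)

/-! ### Correctness of the algorithm -/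

/-- `A` is a symmetric matrix and `L` a list of distinct indices of its rows. -/
structure Valid (A : List (List ℕ)) (L : List ℕ) : Prop where
  symm : ∀ i < A.length, ∀ j < A.length, entry A i j = entry A j i
  nodup : L.Nodup
  lt : ∀ x ∈ L, x < A.length

/-- `H` computes hafnians modulo `M`. -/
def Computes (M : ℕ) (H : List (List ℕ) × List ℕ → ℕ) : Prop :=
  ∀ A L, Valid A L → H (A, L) ≡ hf (entry A) L.toFinset [MOD M]

theorem mem_del {L : List ℕ} {x y : ℕ} : y ∈ del L x ↔ y ≠ x ∧ y ∈ L := by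
  simp [del, and_comm]

theorem toFinset_del (L : List ℕ) (x : ℕ) : (del L x).toFinset = L.toFinset.erase x := by
  ext y; simp [mem_del]

theorem Valid.mono {A L L'} (h : Valid A L) (h' : L'.Sublist L) : Valid A L' :=
  ⟨h.symm, h.nodup.sublist h', fun x hx => h.lt x (h'.subset hx)⟩

theorem Valid.del {A L} (h : Valid A L) (x : ℕ) : Valid A (del L x) := h.mono List.filter_sublist

/-- A factor two allows to compute with half the precision. -/
theorem Computes.even_mul {M : ℕ} {H} (hH : Computes M H) {A L} (h : Valid A L) {x : ℕ}
    (hx : x % 2 = 0) :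
    ((x * H (A, L) : ℕ) : ZMod (2 * M)) = (x * hf (entry A) L.toFinset : ℕ) := by
  rw [ZMod.natCast_eq_natCast_iff]
  obtain ⟨y, rfl⟩ : 2 ∣ x := Nat.dvd_of_mod_eq_zero hx
  rw [mul_comm 2 y, mul_assoc, mul_assoc]
  exact ((hH A L h).mul_left' 2).mul_left y

theorem sum_map_eq {L : List ℕ} (hL : L.Nodup) (f : ℕ → ℕ) :
    (L.map f).sum = ∑ x ∈ L.toFinset, f x := (List.sum_toFinset f hL).symm

theorem natCast_hf (N : ℕ) (A : List (List ℕ)) (s : Finset ℕ) :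
    ((hf (entry A) s : ℕ) : ZMod N) = hf (fun x y => (entry A x y : ZMod N)) s :=
  map_hf (Nat.castRingHom (ZMod N)) (entry A) s

theorem Computes.expansion {M : ℕ} {H} (hH : Computes M H) {A T U} (hT : Valid A T) (hU : U.Nodup)
    {v : ℕ} (hv : ∀ x ∈ U, entry A v x % 2 = 0) :
    (expansion H A T U v : ZMod (2 * M)) = ∑ x ∈ U.toFinset,
      (entry A v x : ZMod (2 * M)) * (hf (entry A) (T.toFinset.erase x) : ℕ) := by
  rw [HafnianModTwoPow.expansion, sum_map_eq hU, Nat.cast_sum]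
  refine Finset.sum_congr rfl fun x hx => ?_
  rw [hH.even_mul (hT.del x) (hv x (by simpa using hx)), toFinset_del, Nat.cast_mul]

theorem Computes.corr {M : ℕ} {H} (hH : Computes M H) {A T} (hT : Valid A T) (w : ℕ) :
    (2 * corr H A T w : ZMod (2 * M)) = 2 * ∑ p ∈ T.toFinset, ∑ q ∈ T.toFinset, if p < q then
      (entry A w p : ZMod (2 * M)) * entry A w q *
        hf (fun x y => (entry A x y : ZMod (2 * M))) ((T.toFinset.erase p).erase q) else 0 := by
  rw [HafnianModTwoPow.corr, sum_map_eq hT.nodup, Nat.cast_sum, Finset.mul_sum, Finset.mul_sum]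
  refine Finset.sum_congr rfl fun p _ => ?_
  rw [sum_map_eq hT.nodup, Nat.cast_sum, Finset.mul_sum, Finset.mul_sum]
  refine Finset.sum_congr rfl fun q _ => ?_
  split_ifs
  · have := hH.even_mul ((hT.del p).del q) (x := 2) rfl
    rw [toFinset_del, toFinset_del] at this
    push_cast [natCast_hf] at this ⊢
    linear_combination (entry A w p : ZMod (2 * M)) * entry A w q * this
  · simp

theorem length_rowOp (N A u w c) : (rowOp N A u w c).length = A.length := length_tab _ _ _

theorem Valid.rowOp {A L} (h : Valid A L) (N : ℕ) {u w : ℕ} (hw : w < A.length)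
    (huw : u ≠ w) (c : ℕ) : Valid (rowOp N A u w c) L := by
  refine ⟨fun i hi j hj => ?_, h.nodup, fun x hx => ?_⟩
  · rw [length_rowOp] at hi hj
    rw [HafnianModTwoPow.rowOp, entry_tab hi hj, entry_tab hj hi]
    congr 1
    have h1 := h.symm i hi j hj
    have h2 := h.symm w hw j hj
    have h3 := h.symm i hi w hw
    unfold rowOpEntry
    split_ifs <;> simp_all
  · rw [length_rowOp]; exact h.lt x hx

/-- The row operation that makes an entry even, together with its correction, does not change the
quantity to be computed. -/
theorem Computes.clear {M : ℕ} (hM : 0 < M) {H} (hH : Computes M H) {A L} (h : Valid A L)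
    {v w : ℕ} {u : ℕ} (hu : u ∈ L) (hw : w ∈ L) (huw : u ≠ w) (coef acc : ℕ) :
    ((clearEntry (2 * M) H L v w coef (A, acc) u).2 : ZMod (2 * M)) +
      coef * (hf (entry (clearEntry (2 * M) H L v w coef (A, acc) u).1) L.toFinset : ℕ) =
    acc + coef * (hf (entry A) L.toFinset : ℕ) := by
  set c := entry A v u with hc
  have hs : ∀ x ∈ L.toFinset, x < A.length := fun x hx => h.lt x (by simpa using hx)
  have hB := h.rowOp (2 * M) (h.lt w hw) huw c
  have e : ∀ x < A.length, ∀ y < A.length, (entry (HafnianModTwoPow.rowOp (2 * M) A u w c) x y :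
      ZMod (2 * M)) = (rowOpEntry A u w c x y : ℕ) := fun x hx y hy => by
    rw [HafnianModTwoPow.rowOp, entry_tab hx hy, ZMod.natCast_mod]
  have h1 := hf_row_op (a := fun x y => (entry A x y : ZMod (2 * M)))
    (b := fun x y => (entry (HafnianModTwoPow.rowOp (2 * M) A u w c) x y : ZMod (2 * M)))
    (s := L.toFinset) (u := u) (w := w) (c : ZMod (2 * M)) (by simpa using hu) (by simpa using hw)
    huw
    (fun x hx y hy => by rw [h.symm x (hs x hx) y (hs y hy)])
    (fun x hx y hy => by
      rw [hB.symm x (by rw [length_rowOp]; exact hs x hx) y (by rw [length_rowOp]; exact hs y hy)])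
    (fun x hx y hy _ => by
      rw [Finset.mem_erase] at hx hy
      rw [e x (hs x hx.2) y (hs y hy.2), rowOpEntry, if_neg hx.1, if_neg hy.1])
    (by rw [e u (h.lt u hu) w (h.lt w hw), rowOpEntry, if_pos rfl, if_pos rfl])
    (fun q hq => by
      rw [Finset.mem_erase, Finset.mem_erase] at hq
      rw [e u (h.lt u hu) q (hs q hq.2.2), rowOpEntry, if_pos rfl, if_neg hq.1]
      push_cast
      rfl)
  have h2 := hH.corr ((h.del u).del w) w
  rw [toFinset_del, toFinset_del] at h2
  simp only [clearEntry, ← hc]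
  rw [natCast_hf, natCast_hf, h1, ZMod.natCast_mod]
  have h3 : ((2 * M - 1 : ℕ) : ZMod (2 * M)) = -1 := by
    rw [Nat.cast_sub (by omega), ZMod.natCast_self]; simp
  push_cast [h3]
  linear_combination -(coef * c : ZMod (2 * M)) * h2

theorem entry_clear_mod_two {M : ℕ} {H A L} {v w u x : ℕ} (hvu : v ≠ u) (hv : v < A.length)
    (hx : x < A.length) (hxu : x ≠ u) (coef acc : ℕ) :
    entry (clearEntry (2 * M) H L v w coef (A, acc) u).1 v x % 2 = entry A v x % 2 := by
  simp only [clearEntry, rowOp]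
  rw [entry_tab hv hx, rowOpEntry, if_neg hvu, if_neg hxu, Nat.mod_mod_of_dvd _ ⟨M, rfl⟩]

theorem entry_clear_self_mod_two {M : ℕ} {H A L} {v w u : ℕ} (hvu : v ≠ u) (hvw : v ≠ w)
    (hv : v < A.length) (hu : u < A.length) (hodd : entry A v w % 2 = 1) (coef acc : ℕ) :
    entry (clearEntry (2 * M) H L v w coef (A, acc) u).1 v u % 2 = 0 := by
  simp only [clearEntry, rowOp]
  rw [entry_tab hv hu, rowOpEntry, if_neg hvu, if_pos rfl, if_neg hvw,
    Nat.mod_mod_of_dvd _ ⟨M, rfl⟩, Nat.add_mod, Nat.mul_mod, hodd]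
  omega

/-- After the row operations for all `u` in a list, the entries `(v, u)` are even, and the quantity
to be computed is unchanged. -/
theorem Computes.foldl_clear {M : ℕ} (hM : 0 < M) {H} (hH : Computes M H) {L} {v w : ℕ}
    (hv : v ∈ L) (hw : w ∈ L) (hvw : v ≠ w) (coef : ℕ) (U : List ℕ) :
    ∀ (A : List (List ℕ)) (acc : ℕ), Valid A L → entry A v w % 2 = 1 → U.Nodup →
      (∀ u ∈ U, u ∈ L ∧ u ≠ w ∧ u ≠ v) →
      Valid (U.foldl (clearEntry (2 * M) H L v w coef) (A, acc)).1 L ∧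
      ((U.foldl (clearEntry (2 * M) H L v w coef) (A, acc)).2 : ZMod (2 * M)) + coef *
        (hf (entry (U.foldl (clearEntry (2 * M) H L v w coef) (A, acc)).1) L.toFinset : ℕ) =
        acc + coef * (hf (entry A) L.toFinset : ℕ) ∧
      (∀ u ∈ U, entry (U.foldl (clearEntry (2 * M) H L v w coef) (A, acc)).1 v u % 2 = 0) ∧
      ∀ x < A.length, x ∉ U →
        entry (U.foldl (clearEntry (2 * M) H L v w coef) (A, acc)).1 v x % 2 = entry A v x % 2 := by
  induction U with
  | nil => intro A acc hA _ _ _; simpa using hA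
  | cons u U ih =>
    intro A acc hA hodd hU hUL
    rw [List.nodup_cons] at hU
    obtain ⟨huL, huw, huv⟩ := hUL u List.mem_cons_self
    have hlen : (clearEntry (2 * M) H L v w coef (A, acc) u).1.length = A.length :=
      length_rowOp _ _ _ _ _
    have hvA := hA.lt v hv
    have h1 := hH.clear hM hA (v := v) huL hw huw coef acc
    obtain ⟨i1, i2, i3, i4⟩ := ih (clearEntry (2 * M) H L v w coef (A, acc) u).1
      (clearEntry (2 * M) H L v w coef (A, acc) u).2 (hA.rowOp _ (hA.lt w hw) huw _)
      (by rw [entry_clear_mod_two huv.symm hvA (hA.lt w hw) huw.symm, hodd]) hU.2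
      fun x hx => hUL x (List.mem_cons_of_mem _ hx)
    rw [List.foldl_cons]
    refine ⟨i1, i2.trans h1, fun x hx => ?_, fun x hx hxU => ?_⟩
    · rcases List.mem_cons.1 hx with rfl | hx
      · rw [i4 x (by rw [hlen]; exact hA.lt x huL) hU.1,
          entry_clear_self_mod_two huv.symm hvw hvA (hA.lt x huL) hodd]
      · exact i3 x hx
    · rw [List.mem_cons, not_or] at hxU
      rw [i4 x (by rw [hlen]; exact hx) hxU.2, entry_clear_mod_two huv.symm hvA hx hxU.1]

/-- The quantity that a state of the elimination stands for. -/
def value (N : ℕ) (s : ElimState) : ZMod N :=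
  s.2.2.2 + s.2.2.1 * (hf (entry s.1) s.2.1.toFinset : ℕ)

theorem hf_entry_cons {A v T} (h : Valid A (v :: T)) :
    hf (entry A) (v :: T).toFinset =
      ∑ x ∈ T.toFinset, entry A v x * hf (entry A) (T.toFinset.erase x) := by
  have hv : v ∉ T := (List.nodup_cons.1 h.nodup).1
  rw [hf_expand _ (fun x hx y hy => h.symm x (h.lt x (by simpa using hx)) y
    (h.lt y (by simpa using hy))) (v := v) (by simp), List.toFinset_cons,
    Finset.erase_insert (by simpa using hv)]

/-- A step of the elimination preserves the value of the state, although `H` is right only modulo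
`M`, and it removes a vertex if there is one. -/
theorem Computes.elimStep {M : ℕ} (hM : 0 < M) {H} (hH : Computes M H) (s : ElimState)
    (hs : Valid s.1 s.2.1) :
    Valid (elimStep (2 * M) H s).1 (elimStep (2 * M) H s).2.1 ∧
    value (2 * M) (elimStep (2 * M) H s) = value (2 * M) s ∧
    (elimStep (2 * M) H s).2.1.length ≤ s.2.1.length - 1 := by
  obtain ⟨A, L, coef, acc⟩ := s
  simp only at hs
  cases L with
  | nil => simpa [HafnianModTwoPow.elimStep] using hs
  | cons v T =>
  have hvT : v ∉ T := (List.nodup_cons.1 hs.nodup).1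
  have hT : T.Nodup := (List.nodup_cons.1 hs.nodup).2
  have hsT : Valid A T := hs.mono (List.sublist_cons_self v T)
  simp only [HafnianModTwoPow.elimStep, List.length_cons, Nat.succ_ne_zero, if_false,
    List.headD_cons, List.tail_cons, List.length_eq_zero_iff]
  by_cases hO : oddCols A (v :: T) = []
  · rw [if_pos hO]
    refine ⟨hs.mono (by simp), ?_, by simp⟩
    have hev : ∀ x ∈ T, entry A v x % 2 = 0 := fun x hx => by
      have := List.filter_eq_nil_iff.1 hO x hx
      simp at this
      omega
    simp only [value, List.toFinset_nil, hf_empty, ZMod.natCast_mod]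
    rw [hf_entry_cons hs]
    push_cast [hH.expansion hsT hT hev]
    ring
  · rw [if_neg hO]
    obtain ⟨w, hwO, hw⟩ : ∃ w ∈ oddCols A (v :: T), (oddCols A (v :: T)).headD 0 = w := by
      obtain ⟨w, O, h⟩ := List.exists_cons_of_ne_nil hO
      exact ⟨w, by simp [h], by simp [h]⟩
    rw [hw]
    obtain ⟨hwT, hodd⟩ : w ∈ T ∧ entry A v w % 2 = 1 := by simpa [oddCols] using hwO
    have hvw : v ≠ w := fun h => hvT (h ▸ hwT)
    have hUT : (HafnianModTwoPow.del T w).Sublist T := List.filter_sublist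
    obtain ⟨i1, i2, i3, i4⟩ := hH.foldl_clear hM (L := v :: T) List.mem_cons_self
      (List.mem_cons_of_mem _ hwT) hvw coef (del T w) A acc hs hodd (hT.sublist hUT) fun u hu => by
        rw [mem_del] at hu
        exact ⟨List.mem_cons_of_mem _ hu.2, hu.1, fun h => hvT (h ▸ hu.2)⟩
    simp only [pivotStep, List.tail_cons]
    set r := (del T w).foldl (clearEntry (2 * M) H (v :: T) v w coef) (A, acc) with hr
    refine ⟨i1.mono (hUT.trans (List.sublist_cons_self v T)), ?_, ?_⟩
    · simp only [value, ZMod.natCast_mod, toFinset_del]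
      rw [← i2, hf_entry_cons i1, ← Finset.add_sum_erase _ _ (List.mem_toFinset.2 hwT),
        ← toFinset_del]
      push_cast [hH.expansion (i1.mono (List.sublist_cons_self v T)) (hT.sublist hUT) i3]
      ring
    · have : (del T w).length < T.length := by
        refine lt_of_le_of_ne hUT.length_le fun h => ?_
        have := hUT.eq_of_length h
        have hw' : w ∈ del T w := by rw [this]; exact hwT
        rw [mem_del] at hw'
        exact hw'.1 rfl
      simp only [Nat.add_sub_cancel]
      omega

/-- The algorithm computes the hafnian modulo `2 ^ k`. -/
theorem computes_hafAlgo (k : ℕ) : Computes (2 ^ k) (hafAlgo k) := by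
  induction k with
  | zero => intro A L _; exact Nat.modEq_one
  | succ k ih =>
    intro A L h
    have key : ∀ n, Valid ((elimStep (2 ^ (k + 1)) (hafAlgo k))^[n] (A, L, 1, 0)).1
        ((elimStep (2 ^ (k + 1)) (hafAlgo k))^[n] (A, L, 1, 0)).2.1 ∧
        value (2 ^ (k + 1)) ((elimStep (2 ^ (k + 1)) (hafAlgo k))^[n] (A, L, 1, 0)) =
          value (2 ^ (k + 1)) (A, L, 1, 0) ∧
        ((elimStep (2 ^ (k + 1)) (hafAlgo k))^[n] (A, L, 1, 0)).2.1.length ≤ L.length - n := by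
      intro n
      induction n with
      | zero => exact ⟨h, rfl, le_rfl⟩
      | succ n ihn =>
        rw [Function.iterate_succ_apply']
        rw [pow_succ'] at ihn ⊢
        have := ih.elimStep (Nat.two_pow_pos k) _ ihn.1
        exact ⟨this.1, this.2.1.trans ihn.2.1, by omega⟩
    obtain ⟨_, h2, h3⟩ := key L.length
    rw [← ZMod.natCast_eq_natCast_iff]
    simp only [hafAlgo]
    set s := (elimStep (2 ^ (k + 1)) (hafAlgo k))^[L.length] (A, L, 1, 0)
    have hs : s.2.1 = [] := List.eq_nil_of_length_eq_zero (by omega)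
    simp only [value, hs] at h2
    rw [ZMod.natCast_mod]
    simpa using h2

/-! ### The algorithm runs in polynomial time -/

namespace PF

theorem entry {A : α → List (List ℕ)} {i j : α → ℕ} (hA : PF A) (hi : PF i) (hj : PF j) :
    PF fun a => entry (A a) (i a) (j a) :=
  (hA.getD hi []).getD hj 0

theorem tab {N : ℕ} {m : α → ℕ} {f : α → ℕ → ℕ → ℕ} (hm : PF m)
    (hf : PF fun p : (α × ℕ) × ℕ => f p.1.1 p.1.2 p.2) : PF fun a => tab N (m a) (f a) :=
  map (g := fun a i => (List.range (m a)).map fun j => f a i j % N)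
    (map (α := α × ℕ) (g := fun p j => f p.1 p.2 j % N) (hf.mod_const N) (hm.comp PF.fst).range)
    hm.range

theorem del {L : α → List ℕ} {x : α → ℕ} (hL : PF L) (hx : PF x) : PF fun a => del (L a) (x a) :=
  filter (g := fun a y => decide (y ≠ x a)) (PF.snd.ne (hx.comp PF.fst)) hL

theorem rowOp (N : ℕ) {A : α → List (List ℕ)} {u w c : α → ℕ} (hA : PF A) (hu : PF u) (hw : PF w)
    (hc : PF c) : PF fun a => rowOp N (A a) (u a) (w a) (c a) := by
  have hA' := hA.comp (PF.fst.comp (PF.fst (α := α × ℕ) (β := ℕ)))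
  have hu' := hu.comp (PF.fst.comp (PF.fst (α := α × ℕ) (β := ℕ)))
  have hw' := hw.comp (PF.fst.comp (PF.fst (α := α × ℕ) (β := ℕ)))
  have hc' := hc.comp (PF.fst.comp (PF.fst (α := α × ℕ) (β := ℕ)))
  have hi : PF fun p : (α × ℕ) × ℕ => p.1.2 := PF.snd.comp PF.fst
  have hj : PF fun p : (α × ℕ) × ℕ => p.2 := PF.snd
  have hij := hA'.entry hi hj
  exact tab (f := fun a => rowOpEntry (A a) (u a) (w a) (c a)) hA.length
    (ite_prop (hi.eq hu') (ite_prop (hj.eq hw') hij (hij.add (hc'.mul (hA'.entry hw' hj))))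
      (ite_prop (hj.eq hu') (ite_prop (hi.eq hw') hij (hij.add (hc'.mul (hA'.entry hi hw')))) hij))

theorem corr {H : List (List ℕ) × List ℕ → ℕ} (hH : PF H) {A : α → List (List ℕ)} {T : α → List ℕ}
    {w : α → ℕ} (hA : PF A) (hT : PF T) (hw : PF w) : PF fun a => corr H (A a) (T a) (w a) := by
  have hA' := hA.comp (PF.fst.comp (PF.fst (α := α × ℕ) (β := ℕ)))
  have hT' := hT.comp (PF.fst.comp (PF.fst (α := α × ℕ) (β := ℕ)))
  have hw' := hw.comp (PF.fst.comp (PF.fst (α := α × ℕ) (β := ℕ)))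
  have hp : PF fun p : (α × ℕ) × ℕ => p.1.2 := PF.snd.comp PF.fst
  have hq : PF fun p : (α × ℕ) × ℕ => p.2 := PF.snd
  exact sum (map (g := fun a p => ((T a).map fun q => if p < q then
      HafnianModTwoPow.entry (A a) (w a) p * HafnianModTwoPow.entry (A a) (w a) q *
        H (A a, HafnianModTwoPow.del (HafnianModTwoPow.del (T a) p) q) else 0).sum)
    (sum (map (α := α × ℕ) (g := fun a q => if a.2 < q then
      HafnianModTwoPow.entry (A a.1) (w a.1) a.2 * HafnianModTwoPow.entry (A a.1) (w a.1) q *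
        H (A a.1, HafnianModTwoPow.del (HafnianModTwoPow.del (T a.1) a.2) q) else 0)
      (ite_prop (hp.lt hq) (((hA'.entry hw' hp).mul (hA'.entry hw' hq)).mul
        (hH.comp (hA'.pair ((hT'.del hp).del hq)))) (PF.const 0)) (hT.comp PF.fst))) hT)

theorem expansion {H : List (List ℕ) × List ℕ → ℕ} (hH : PF H) {A : α → List (List ℕ)}
    {T U : α → List ℕ} {v : α → ℕ} (hA : PF A) (hT : PF T) (hU : PF U) (hv : PF v) :
    PF fun a => expansion H (A a) (T a) (U a) (v a) :=
  sum (map (g := fun a x => HafnianModTwoPow.entry (A a) (v a) x *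
      H (A a, HafnianModTwoPow.del (T a) x))
    (((hA.comp PF.fst).entry (hv.comp PF.fst) PF.snd).mul (hH.comp ((hA.comp PF.fst).pair
      ((hT.comp PF.fst).del PF.snd)))) hU)

theorem clearEntry (N : ℕ) {H : List (List ℕ) × List ℕ → ℕ} (hH : PF H) {L : α → List ℕ}
    {v w coef u : α → ℕ} {s : α → List (List ℕ) × ℕ} (hL : PF L) (hv : PF v) (hw : PF w)
    (hcoef : PF coef) (hs : PF s) (hu : PF u) :
    PF fun a => clearEntry N H (L a) (v a) (w a) (coef a) (s a) (u a) := by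
  have he := hs.fst'.entry hv hu
  exact (rowOp N hs.fst' hu hw he).pair ((hs.snd'.add ((PF.const (N - 1)).mul
    ((((PF.const 2).mul he).mul hcoef).mul (corr hH hs.fst' ((hL.del hu).del hw) hw)))).mod_const N)

end PF

/-- A bound on the size of a matrix of residues. -/
def tabBound (N m : ℕ) : ℕ := m * (m * (2 * N + 2) + 1 + 1) + 1

theorem sz_tab_le {N : ℕ} (hN : 0 < N) (m : ℕ) (f) : sz (tab N m f) ≤ tabBound N m := by
  refine (sz_list_le (B := m * (2 * N + 2) + 1) fun r hr => ?_).trans (by simp [tab, tabBound])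
  simp only [tab, List.mem_map] at hr
  obtain ⟨i, _, rfl⟩ := hr
  refine (sz_list_le (B := 2 * N + 1) fun x hx => ?_).trans (by simp)
  simp only [List.mem_map] at hx
  obtain ⟨j, _, rfl⟩ := hx
  rw [sz_nat]
  have := Nat.mod_lt (f i j) hN
  omega

theorem PB.tabBound {t : α → ℕ} (ht : PB t) (N : ℕ) : PB fun a => tabBound N (t a) :=
  (ht.mul (((ht.mul (PB.const (2 * N + 2))).add (PB.const 1)).add (PB.const 1))).add (PB.const 1)

/-- All intermediate results are reduced modulo `N`, so their size does not grow with the number of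
steps: once a row operation has been done, the matrix consists of residues. -/
theorem foldl_clearEntry_bound {N : ℕ} (hN : 0 < N) (H L v w coef) (U : List ℕ) (s) :
    (U.foldl (clearEntry N H L v w coef) s).1.length = s.1.length ∧
    sz (U.foldl (clearEntry N H L v w coef) s).1 ≤ max (sz s.1) (tabBound N s.1.length) ∧
    (U.foldl (clearEntry N H L v w coef) s).2 ≤ max s.2 N := by
  induction U using List.reverseRecOn with
  | nil => simp
  | append_singleton U u ih =>
    rw [List.foldl_concat]
    refine ⟨(length_rowOp _ _ _ _ _).trans ih.1, ?_, ?_⟩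
    · rw [← ih.1]
      exact (sz_tab_le hN _ _).trans (le_max_right _ _)
    · exact (Nat.mod_lt _ hN).le.trans (le_max_right _ _)

namespace PF

theorem pivotStep {N : ℕ} (hN : 0 < N) {H : List (List ℕ) × List ℕ → ℕ} (hH : PF H)
    {s : α → ElimState} {v w : α → ℕ} (hs : PF s) (hv : PF v) (hw : PF w) :
    PF fun a => pivotStep N H (s a) (v a) (w a) := by
  have hA := hs.fst'
  have hL := hs.snd'.fst'
  have hcoef := hs.snd'.snd'.fst'
  have hacc := hs.snd'.snd'.snd'
  have hU := hL.tail.del hw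
  have hr : PF fun a => (HafnianModTwoPow.del (s a).2.1.tail (w a)).foldl
      (HafnianModTwoPow.clearEntry N H (s a).2.1 (v a) (w a) (s a).2.2.1)
      ((s a).1, (s a).2.2.2) := by
    refine foldl (g := fun a => HafnianModTwoPow.clearEntry N H (s a).2.1 (v a) (w a) (s a).2.2.1)
      (clearEntry N hH (hL.comp PF.fst) (hv.comp PF.fst) (hw.comp PF.fst) (hcoef.comp PF.fst)
      PF.snd.fst' PF.snd.snd') hU (hA.pair hacc)
      (((hA.size.add (hA.size.tabBound N)).add (hacc.size.mul (PB.const 2))).add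
        (PB.const (2 * N + 2)))
      fun a l' _ => ?_
    obtain ⟨_, h2, h3⟩ := foldl_clearEntry_bound hN H (s a).2.1 (v a) (w a) (s a).2.2.1 l'
      ((s a).1, (s a).2.2.2)
    have h4 : HafnianModTwoPow.tabBound N (s a).1.length ≤
        HafnianModTwoPow.tabBound N (sz (s a).1) := by
      unfold HafnianModTwoPow.tabBound
      have := length_le_sz (s a).1
      gcongr
    rw [← Prod.mk.eta (p := List.foldl _ _ _), sz_pair, sz_nat]
    simp only [sz_nat] at *
    omega
  exact hr.fst'.pair (hU.pair ((hcoef.mul (hr.fst'.entry hv hw)).mod_const N |>.pair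
    ((hr.snd'.add (hcoef.mul (expansion hH hr.fst' hL.tail hU hv))).mod_const N)))

theorem elimStep {N : ℕ} (hN : 0 < N) {H : List (List ℕ) × List ℕ → ℕ} (hH : PF H) :
    PF (elimStep N H) := by
  have hs : PF fun s : ElimState => s := PF.id
  have hA := hs.fst'
  have hL := hs.snd'.fst'
  have hcoef := hs.snd'.snd'.fst'
  have hacc := hs.snd'.snd'.snd'
  have hv := hL.headD 0
  have hO : PF fun s : ElimState => oddCols s.1 s.2.1 :=
    filter (g := fun (s : ElimState) x =>
        decide (HafnianModTwoPow.entry s.1 (s.2.1.headD 0) x % 2 = 1))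
      ((((hA.comp PF.fst).entry (hv.comp PF.fst) PF.snd).mod_const 2).eq (PF.const 1)) hL.tail
  exact ite_prop hL.length.eq_zero hs (ite_prop hO.length.eq_zero
    (hA.pair ((PF.const []).pair ((PF.const 0).pair
      ((hacc.add (hcoef.mul (expansion hH hA hL.tail hL.tail hv))).mod_const N))))
    (pivotStep hN hH hs hv (hO.headD 0)))

end PF

/-- The bounds do not accumulate when the step is repeated, as the maximum with a fixed quantity is
idempotent. -/
theorem elimStep_bound {N : ℕ} (hN : 0 < N) (H) (s : ElimState) :
    (elimStep N H s).1.length = s.1.length ∧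
    sz (elimStep N H s).1 ≤ max (sz s.1) (tabBound N s.1.length) ∧
    (elimStep N H s).2.1.Sublist s.2.1 ∧
    (elimStep N H s).2.2.1 ≤ max s.2.2.1 N ∧ (elimStep N H s).2.2.2 ≤ max s.2.2.2 N := by
  unfold elimStep
  split_ifs
  · simp
  · exact ⟨rfl, le_max_left _ _, List.nil_sublist _, Nat.zero_le _,
      (Nat.mod_lt _ hN).le.trans (le_max_right _ _)⟩
  · obtain ⟨h1, h2, -⟩ := foldl_clearEntry_bound hN H s.2.1 (s.2.1.headD 0)
      ((oddCols s.1 s.2.1).headD 0) s.2.2.1 (del s.2.1.tail ((oddCols s.1 s.2.1).headD 0))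
      (s.1, s.2.2.2)
    exact ⟨h1, h2, List.filter_sublist.trans (List.tail_sublist _),
      (Nat.mod_lt _ hN).le.trans (le_max_right _ _), (Nat.mod_lt _ hN).le.trans (le_max_right _ _)⟩

theorem elimStep_iterate_bound {N : ℕ} (hN : 0 < N) (H) (A : List (List ℕ)) (L : List ℕ) (n : ℕ) :
    ((elimStep N H)^[n] (A, L, 1, 0)).1.length = A.length ∧
    sz ((elimStep N H)^[n] (A, L, 1, 0)).1 ≤ max (sz A) (tabBound N A.length) ∧
    ((elimStep N H)^[n] (A, L, 1, 0)).2.1.Sublist L ∧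
    ((elimStep N H)^[n] (A, L, 1, 0)).2.2.1 ≤ max 1 N ∧
    ((elimStep N H)^[n] (A, L, 1, 0)).2.2.2 ≤ max 0 N := by
  induction n with
  | zero => simp
  | succ n ihn =>
    rw [Function.iterate_succ_apply']
    obtain ⟨i1, i2, i3, i4, i5⟩ := ihn
    obtain ⟨j1, j2, j3, j4, j5⟩ := elimStep_bound hN H ((elimStep N H)^[n] (A, L, 1, 0))
    rw [i1] at j1 j2
    exact ⟨j1, by omega, j3.trans i3, by omega, by omega⟩

/-- For every fixed `k` the algorithm runs in polynomial time: precision `k + 1` composes the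
function for precision `k` with a bounded number of polynomial-time constructions, so that the
degree of the polynomial may grow with `k`. -/
theorem PF.hafAlgo (k : ℕ) : PF (hafAlgo k) := by
  induction k with
  | zero => exact PF.const 0
  | succ k ih =>
    have hN : 0 < 2 ^ (k + 1) := Nat.two_pow_pos _
    set N := 2 ^ (k + 1) with hNdef
    have hA : PF fun p : List (List ℕ) × List ℕ => p.1 := PF.fst
    have hL : PF fun p : List (List ℕ) × List ℕ => p.2 := PF.snd
    have hs : PF fun p : List (List ℕ) × List ℕ =>
        (HafnianModTwoPow.elimStep N (HafnianModTwoPow.hafAlgo k))^[p.2.length]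
          (p.1, p.2, 1, 0) := by
      refine iterate (elimStep hN ih) hL (hA.pair (hL.pair (PF.const (1, 0))))
        (((hA.size.add (hA.size.tabBound N)).add hL.size).add (PB.const (4 * N + 10)))
        fun p n _ => ?_
      obtain ⟨h1, h2, h3, h4, h5⟩ :=
        elimStep_iterate_bound hN (HafnianModTwoPow.hafAlgo k) p.1 p.2 n
      have h6 := sz_sublist_le h3
      have h7 : tabBound N p.1.length ≤ tabBound N (sz p.1) := by
        unfold tabBound
        have := length_le_sz p.1
        gcongr
      generalize
        (HafnianModTwoPow.elimStep N (HafnianModTwoPow.hafAlgo k))^[n] (p.1, p.2, 1, 0) = s at *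
      obtain ⟨A', L', c', a'⟩ := s
      simp only [sz_pair, sz_nat] at *
      omega
    exact (hs.snd'.snd'.snd'.add hs.snd'.snd'.fst').mod_const N

/-! ### Reading the input and writing the output -/

/-- The number of a symbol. -/
def symIdx : Sym → ℕ
  | .bit false => 0
  | .bit true => 1
  | .minus => 2
  | .endEntry => 3
  | .endRow => 4

/-- Symbols are represented by their numbers: `symIdx` does not change the representation. -/
instance : Enc Sym := ⟨fun s => natTree (symIdx s)⟩

instance : Inhabited Sym := ⟨.minus⟩

theorem sz_sym_le (s : Sym) : sz s ≤ 9 := by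
  rcases s with (_ | _) | _ | _ | _ <;> decide

theorem PF.symIdx {α : Type} [Enc α] {s : α → Sym} (hs : PF s) : PF fun a => symIdx (s a) :=
  (PF.of_word_eq (f := HafnianModTwoPow.symIdx) fun _ => rfl).comp hs

/-- Push the word of the symbol in the register on the main stack, provided that it is in the
list. -/
def pushCode : List Sym → SProg
  | [] => .load id
  | s :: l => .cond (fun v => v = some s) (pushWord (word s)) (pushCode l)

/-- The stack contents while the input is read. -/
def inputBase (M I : List Sym) : Stk → List Sym
  | .main => M
  | .inp => I
  | _ => []

theorem exec_pushMain_inputBase (s : Sym) (M I : List Sym) (v) :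
    Exec (pushSym .main s) v (inputBase M I) v (inputBase (s :: M) I) 1 := by
  refine Exec.of_eq (exec_pushSym) ?_ le_rfl
  funext k
  cases k <;> simp [inputBase, Function.update]

theorem exec_pushWord_inputBase (l M I : List Sym) (v) :
    Exec (pushWord l) v (inputBase M I) v (inputBase (l ++ M) I) (l.length + 1) := by
  induction l with
  | nil => exact Exec.load (g := id)
  | cons s l ih => exact (ih.seq (exec_pushMain_inputBase s _ I v)).mono (by simp)

theorem exec_pushCode {s : Sym} (l : List Sym) (hs : s ∈ l) (M I : List Sym) :
    Exec (pushCode l) (some s) (inputBase M I) (some s) (inputBase (word s ++ M) I)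
      (l.length + 10) := by
  induction l with
  | nil => simp at hs
  | cons s' l ih =>
    by_cases h : s = s'
    · subst h
      have := sz_sym_le s
      exact (Exec.cond_true (by simp) (exec_pushWord_inputBase (word s) M I _)).mono
        (by simp only [sz] at this; simp; omega)
    · exact (Exec.cond_false (by simpa using h)
        (ih (by simpa [h] using hs))).mono (by simp)

/-- The loop of `readInput`. -/
def readLoop : SProg :=
  .loop Option.isSome (.seq (pushCode [.bit false, .bit true, .minus, .endEntry, .endRow])
    (.seq (pushSym .main (.bit true)) (popReg .inp)))

/-- Turn the input into a list of symbols on the main stack, in reversed order. -/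
def readInput : SProg := .seq (pushSym .main (.bit false)) (.seq (popReg .inp) readLoop)

theorem exec_popInp (M I : List Sym) (v) :
    Exec (popReg .inp) v (inputBase M I) I.head? (inputBase M I.tail) 1 := by
  refine Exec.of_eq (exec_popReg) ?_ le_rfl
  funext k
  cases k <;> simp [inputBase, Function.update]

theorem exec_readLoop (I : List Sym) : ∀ W : List Sym,
    Exec readLoop I.head? (inputBase (word W) I.tail) none (inputBase (word (I.reverse ++ W)) [])
      (18 * I.length + 1) := by
  induction I with
  | nil => intro W; exact Exec.loop_false rfl
  | cons s I ih =>
    intro W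
    have h1 := exec_pushCode (s := s) [.bit false, .bit true, .minus, .endEntry, .endRow]
      (by rcases s with (_ | _) | _ | _ | _ <;> simp) (word W) I
    have h2 := exec_pushMain_inputBase (.bit true) (word s ++ word W) I (some s)
    have h3 := ih (s :: W)
    rw [word_cons] at h3
    rw [show (s :: I).reverse ++ W = I.reverse ++ s :: W by simp]
    exact (Exec.loop_true rfl (h1.seq (h2.seq (exec_popInp _ _ _))) h3).mono (by simp; omega)

theorem exec_readInput (I : List Sym) :
    Exec readInput none (inputBase [] I) none (base (word I.reverse) []) (18 * I.length + 3) := by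
  have h := (exec_pushMain_inputBase (.bit false) [] I none).seq ((exec_popInp _ _ _).seq
    (exec_readLoop I []))
  refine Exec.of_eq h ?_ (by omega)
  rw [List.append_nil]
  funext k
  cases k <;> rfl

/-- The loop of `writeOutput`. -/
def writeLoop : SProg :=
  .loop (fun v => v = some (.bit true)) (.seq (popReg .main) (.seq
    (.push none fun v => decide (v = some (.bit true))) (.seq
    (.cond (fun v => v = some (.bit true)) (.seq (popReg .main) (popReg .main)) (.load id))
    (popReg .main))))

/-- Move a list of bits from the main stack to the output stack, in reversed order. -/
def writeOutput : SProg := .seq (popReg .main) (.seq writeLoop (.load fun _ => none))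

theorem run_popMain (s : Sym) (M : List Sym) (O : List Bool) (v) :
    Prog.Run (popReg .main) v (stk (base (s :: M) []) O) (some s) (stk (base M []) O) 1 := by
  have h : stk (base M []) O = Function.update (stk (base (s :: M) []) O) (some .main) M := by
    rw [update_stk]
    congr 1
    funext k
    cases k <;> simp [base, Function.update]
  rw [h]
  exact Prog.Run.pop (Γ := Alph) (k := some .main) (f := fun _ o => o)

theorem run_pushOut (M : List Sym) (O : List Bool) (v : Option Sym) (f : Option Sym → Bool) :
    Prog.Run (.push none f : SProg) v (stk (base M []) O) v (stk (base M []) (f v :: O)) 1 := by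
  have h : stk (base M []) (f v :: O) = Function.update (stk (base M []) O) none (f v :: O) := by
    funext k
    cases k <;> simp [stk, Function.update]
  rw [h]
  exact Prog.Run.push (Γ := Alph) (k := none) (f := f)

theorem run_writeLoop (l : List Bool) : ∀ O : List Bool, ∃ t ≤ 7 * l.length + 1,
    Prog.Run writeLoop (word l).head? (stk (base (word l).tail []) O) (some (.bit false))
      (stk (base [] []) (l.reverse ++ O)) t := by
  induction l with
  | nil => intro O; exact ⟨1, by simp, .loop_false (by decide)⟩
  | cons b l ih =>
    intro O
    obtain ⟨c, w, hw⟩ : ∃ c w, word l = c :: w := by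
      cases hl : word l with
      | nil => have := one_le_sz l; simp [sz, hl] at this
      | cons c w => exact ⟨c, w, rfl⟩
    obtain ⟨t, ht, r⟩ := ih (b :: O)
    rw [hw] at r
    rw [word_cons, show (b :: l).reverse ++ O = l.reverse ++ b :: O by simp, hw]
    cases b with
    | true =>
      refine ⟨1 + (1 + ((1 + 1 + 1) + 1)) + t + 1, by simp; omega, ?_⟩
      exact .loop_true (by simp) (.seq (run_popMain (.bit true) _ _ _)
        (.seq (run_pushOut _ _ _ _) (.seq (.cond_true (by decide)
        (.seq (run_popMain _ _ _ _) (run_popMain _ _ _ _))) (run_popMain c w _ _)))) r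
    | false =>
      refine ⟨1 + (1 + ((1 + 1) + 1)) + t + 1, by simp; omega, ?_⟩
      exact .loop_true (by simp) (.seq (run_popMain (.bit false) _ _ _)
        (.seq (run_pushOut _ _ _ _) (.seq (.cond_false (by decide) .load)
        (run_popMain c w _ _)))) r

theorem run_writeOutput (l : List Bool) : ∃ t ≤ 7 * l.length + 3,
    Prog.Run writeOutput none (stk (base (word l) []) []) none (stk (base [] []) l.reverse) t := by
  obtain ⟨c, w, hw⟩ : ∃ c w, word l = c :: w := by
    cases hl : word l with
    | nil => have := one_le_sz l; simp [sz, hl] at this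
    | cons c w => exact ⟨c, w, rfl⟩
  obtain ⟨t, ht, r⟩ := run_writeLoop l []
  rw [hw, List.append_nil] at r
  refine ⟨1 + (t + 1), by omega, ?_⟩
  rw [hw]
  exact .seq (run_popMain c w _ _) (.seq r .load)

theorem stk_input (I : List Sym) : stk (inputBase [] I) [] =
    Function.update (β := fun k => List (Alph k)) (fun _ => []) (some Stk.inp) I := by
  funext k
  rcases k with _ | (_ | _ | _ | _ | _ | _) <;> simp [stk, inputBase, Function.update]

theorem stk_output (O : List Bool) : stk (base [] []) O =
    Function.update (β := fun k => List (Alph k)) (fun _ => []) none O := by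
  funext k
  rcases k with _ | (_ | _ | _ | _ | _ | _) <;> simp [stk, base, Function.update]

/-- A program for a polynomial-time function, together with the input and output routines. -/
theorem exists_run_of_PF {g : List Sym → List Bool} (hg : PF g) :
    ∃ (prog : SProg) (T : Polynomial ℕ), ∀ I : List Sym, ∃ t, t + 1 ≤ T.eval I.length ∧
      Prog.Run prog none (stk (inputBase [] I) []) none
        (stk (base [] []) (g I.reverse).reverse) t := by
  obtain ⟨q, hq⟩ := hg.size
  obtain ⟨P, p, hp⟩ := hg
  have hsz : ∀ l : List Sym, sz l ≤ 10 * l.length + 1 := fun l => by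
    have := sz_list_le (l := l) (B := 9) fun s _ => sz_sym_le s
    omega
  refine ⟨.seq readInput (.seq P writeOutput), 18 * .X + 7 + p.comp (10 * .X + 1) +
    7 * q.comp (10 * .X + 1), fun I => ?_⟩
  obtain ⟨t₁, ht₁, r₁⟩ := exec_readInput I
  obtain ⟨t₂, ht₂, r₂⟩ := hp I.reverse [] []
  obtain ⟨t₃, ht₃, r₃⟩ := run_writeOutput (g I.reverse)
  rw [List.append_nil, List.append_nil] at r₂
  refine ⟨_, ?_, .seq r₁ (.seq r₂ r₃)⟩
  have hl := hsz I.reverse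
  rw [List.length_reverse] at hl
  have h1 := eval_mono p hl
  have h2 := eval_mono q hl
  have h3 := (length_le_sz (g I.reverse)).trans (hq _)
  simp only [Polynomial.eval_add, Polynomial.eval_mul, Polynomial.eval_comp,
    Polynomial.eval_X, Polynomial.eval_ofNat, Polynomial.eval_one]
  omega

/-- A function whose reversed output is a polynomial-time function of the reversed input is
computed by a polynomial-time Turing machine. -/
theorem polyTime_of_PF {α : Type} {enc : α → List Sym} {f : α → ℕ} {g : List Sym → List Bool}
    (hg : PF g) (h : ∀ a, g (enc a).reverse = (Computability.encodeNat (f a)).reverse) :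
    PolyTime enc f := by
  obtain ⟨prog, T, hT⟩ := exists_run_of_PF hg
  let _ : Fintype (Alph (some .inp)) := inferInstanceAs (Fintype Sym)
  have key : ∀ a, Nonempty (Turing.TM2OutputsInTime (prog.toTM (some .inp) none none)
      (List.map (Equiv.refl Sym).invFun (enc a))
      (some (List.map (Equiv.refl Bool).invFun (Computability.encodeNat (f a))))
      (T.eval (enc a).length)) := fun a => by
    obtain ⟨t, ht, r⟩ := hT (enc a)
    rw [h, List.reverse_reverse, stk_input, stk_output] at r
    have e₁ : List.map (Equiv.refl Sym).invFun (enc a) = enc a := List.map_id _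
    have e₂ : List.map (Equiv.refl Bool).invFun (Computability.encodeNat (f a)) =
      Computability.encodeNat (f a) := List.map_id _
    rw [← e₁, ← e₂] at r
    exact Prog.outputs_toTM prog (some .inp) none none r ht
  exact ⟨{
    tm := prog.toTM (some .inp) none none
    inputAlphabet := Equiv.refl Sym
    outputAlphabet := Equiv.refl Bool
    time := T
    outputsFun := fun a => (key a).some }⟩

/-! ### Parsing the matrix -/

/-- One step of the parser, which reads the input from its end: it starts a new row or a new entry
at the end marks, and otherwise changes the current entry, the first one of the first row. Since the
least significant digit of an entry comes last in this direction, a digit is read by Horner's rule;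
the minus sign comes after all digits and is multiplication by `N - 1`. -/
def parseStep (N : ℕ) (s : List (List ℕ)) (x : Sym) : List (List ℕ) :=
  if symIdx x = 4 then [] :: s
  else if symIdx x = 3 then (0 :: s.headD []) :: s.tail
  else if symIdx x = 2 then
    ((N - 1) * (s.headD []).headD 0 % N :: (s.headD []).tail) :: s.tail
  else ((2 * (s.headD []).headD 0 + symIdx x) % N :: (s.headD []).tail) :: s.tail

theorem sz_parseStep_le {N : ℕ} (hN : 0 < N) (s : List (List ℕ)) (x : Sym) :
    sz (parseStep N s x) ≤ sz s + (2 * N + 4) := by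
  have h : ∀ (c : ℕ), c ≤ N → sz ((c :: (s.headD []).tail) :: s.tail) ≤ sz s + (2 * N + 4) := by
    intro c hc
    rcases s with _ | ⟨_ | ⟨d, r⟩, s⟩ <;>
      simp only [List.headD_nil, List.headD_cons, List.tail_nil, List.tail_cons, sz_cons, sz_nil,
        sz_nat] <;> omega
  unfold parseStep
  split_ifs
  · rw [sz_cons, sz_nil]; omega
  · rcases s with _ | ⟨r, s⟩ <;>
      simp only [List.headD_nil, List.headD_cons, List.tail_nil, List.tail_cons, sz_cons, sz_nil,
        sz_nat] <;> omega
  · exact h _ (Nat.mod_lt _ hN).le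
  · exact h _ (Nat.mod_lt _ hN).le

theorem PF.parse {N : ℕ} (hN : 0 < N) : PF fun W : List Sym => W.foldl (parseStep N) [] := by
  have hs : PF fun p : List Sym × List (List ℕ) × Sym => p.2.1 := PF.snd.fst'
  have hx : PF fun p : List Sym × List (List ℕ) × Sym => HafnianModTwoPow.symIdx p.2.2 :=
    PF.snd.snd'.symIdx
  have hr := hs.headD []
  have hstep : PF fun p : List Sym × List (List ℕ) × Sym => parseStep N p.2.1 p.2.2 :=
    ite_prop (hx.eq (PF.const 4)) ((PF.const []).cons hs)
    (ite_prop (hx.eq (PF.const 3)) (((PF.const 0).cons hr).cons hs.tail)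
    (ite_prop (hx.eq (PF.const 2))
      (((((PF.const (N - 1)).mul (hr.headD 0)).mod_const N).cons hr.tail).cons hs.tail)
      ((((((PF.const 2).mul (hr.headD 0)).add hx).mod_const N).cons hr.tail).cons hs.tail)))
  refine foldl (g := fun _ => parseStep N) hstep PF.id (PF.const [])
    ((PB.size.mul (PB.const (2 * N + 4))).add (PB.const 1)) fun W l hl => ?_
  have key : ∀ l : List Sym, sz (l.foldl (parseStep N) []) ≤ l.length * (2 * N + 4) + 1 := by
    intro l
    induction l using List.reverseRecOn with
    | nil => simp [sz_nil]
    | append_singleton l x ih =>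
      rw [List.foldl_concat, List.length_append, List.length_singleton, Nat.add_mul]
      have := sz_parseStep_le hN (l.foldl (parseStep N) []) x
      omega
  have := Nat.mul_le_mul_right (2 * N + 4) (hl.length_le.trans (length_le_sz W))
  exact (key l).trans (by omega)

/-- The residue of an integer, as computed by the parser. -/
def residue (N : ℕ) (z : ℤ) : ℕ :=
  if z < 0 then (N - 1) * (z.natAbs % N) % N else z.natAbs % N

theorem natCast_residue {N : ℕ} (hN : 0 < N) (z : ℤ) : (residue N z : ZMod N) = z := by
  have h : ((N - 1 : ℕ) : ZMod N) = -1 := by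
    rw [Nat.cast_sub (by omega), ZMod.natCast_self]; simp
  unfold residue
  split_ifs with hz
  · rw [ZMod.natCast_mod, Nat.cast_mul, h, ZMod.natCast_mod]
    have : z = -(z.natAbs : ℤ) := by omega
    conv_rhs => rw [this]
    rw [Int.cast_neg, Int.cast_natCast, neg_one_mul]
  · rw [ZMod.natCast_mod]
    have : z = (z.natAbs : ℤ) := by omega
    conv_rhs => rw [this]
    rw [Int.cast_natCast]

/-- Reading from the end of the input. -/
def parseBack (N : ℕ) (w : List Sym) (s : List (List ℕ)) : List (List ℕ) :=
  w.foldr (fun x s => parseStep N s x) s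

theorem parseBack_append (N : ℕ) (w w' : List Sym) (s) :
    parseBack N (w ++ w') s = parseBack N w (parseBack N w' s) := List.foldr_append

theorem parseBack_encodePosNum (N : ℕ) (p : PosNum) (r : List ℕ) (s : List (List ℕ)) :
    parseBack N ((Computability.encodePosNum p).map Sym.bit) ((0 :: r) :: s) =
      ((p : ℕ) % N :: r) :: s := by
  induction p with
  | one => simp [Computability.encodePosNum, parseBack, parseStep, symIdx]
  | bit1 p ih =>
    rw [Computability.encodePosNum, List.map_cons, parseBack, List.foldr_cons, ← parseBack, ih]
    simp only [parseStep, symIdx, List.headD_cons, List.tail_cons, PosNum.cast_bit1]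
    simp [Nat.add_mod, two_mul]
  | bit0 p ih =>
    rw [Computability.encodePosNum, List.map_cons, parseBack, List.foldr_cons, ← parseBack, ih]
    simp only [parseStep, symIdx, List.headD_cons, List.tail_cons, PosNum.cast_bit0]
    simp [Nat.add_mod, two_mul]

theorem parseBack_encodeNat (N n : ℕ) (r : List ℕ) (s : List (List ℕ)) :
    parseBack N ((Computability.encodeNat n).map Sym.bit) ((0 :: r) :: s) = (n % N :: r) :: s := by
  have h : ((n : Num) : ℕ) = n := Num.to_of_nat n
  unfold Computability.encodeNat
  cases hn : (n : Num) with
  | zero =>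
    rw [hn] at h
    simp only [Num.cast_zero'] at h
    subst h
    simp [Computability.encodeNum, parseBack]
  | pos p =>
    rw [hn] at h
    rw [Computability.encodeNum, parseBack_encodePosNum]
    rw [← h]
    rfl

theorem parseBack_encodeInt (N : ℕ) (z : ℤ) (r : List ℕ) (s : List (List ℕ)) :
    parseBack N (encodeInt z ++ [.endEntry]) (r :: s) = (residue N z :: r) :: s := by
  have h : parseBack N [.endEntry] (r :: s) = (0 :: r) :: s := rfl
  rw [parseBack_append, h, encodeInt, parseBack_append, parseBack_encodeNat]
  unfold residue
  split_ifs <;> rfl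

theorem parseBack_encodeMatrix (N : ℕ) {m : ℕ} (A : Matrix (Fin m) (Fin m) ℤ) :
    parseBack N (encodeMatrix A) [] =
      (List.finRange m).map fun i => (List.finRange m).map fun j => residue N (A i j) := by
  have hrow : ∀ (f : Fin m → ℤ) (l : List (Fin m)) (r : List ℕ) (s : List (List ℕ)),
      parseBack N (l.flatMap fun j => encodeInt (f j) ++ [.endEntry]) (r :: s) =
        (l.map (fun j => residue N (f j)) ++ r) :: s := by
    intro f l
    induction l with
    | nil => intro r s; rfl
    | cons j l ih =>
      intro r s
      rw [List.flatMap_cons, parseBack_append, ih, parseBack_encodeInt]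
      rfl
  unfold encodeMatrix
  have : ∀ l : List (Fin m), parseBack N (l.flatMap fun i =>
      ((List.finRange m).flatMap fun j => encodeInt (A i j) ++ [Sym.endEntry]) ++ [Sym.endRow]) [] =
      l.map fun i => (List.finRange m).map fun j => residue N (A i j) := by
    intro l
    induction l with
    | nil => rfl
    | cons i l ih =>
      have h : ∀ s, parseBack N [.endRow] s = [] :: s := fun s => rfl
      rw [List.flatMap_cons, parseBack_append, ih, parseBack_append, h, hrow, List.append_nil]
      rfl
  exact this _

theorem entry_map_finRange {m : ℕ} (f : Fin m → Fin m → ℕ) (i j : Fin m) :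
    entry ((List.finRange m).map fun i => (List.finRange m).map fun j => f i j) i j = f i j := by
  simp [entry]

/-! ### The complete algorithm -/

theorem hafAlgo_lt (k : ℕ) (p) : hafAlgo k p < 2 ^ k := by
  cases k with
  | zero => simp [hafAlgo]
  | succ k => exact Nat.mod_lt _ (Nat.two_pow_pos _)

/-- From the reversed input to the reversed output. The residue is converted to binary by looking it
up in a table, whose length `2 ^ k` is fixed. -/
def fullAlgo (k : ℕ) (W : List Sym) : List Bool :=
  ((List.range (2 ^ k)).map fun n => (Computability.encodeNat n).reverse).getD
    (hafAlgo k (W.foldl (parseStep (2 ^ k)) [],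
      List.range (W.foldl (parseStep (2 ^ k)) []).length)) []

theorem PF.fullAlgo (k : ℕ) : PF (fullAlgo k) := by
  have h := PF.parse (Nat.two_pow_pos k)
  exact (PF.const _).getD ((PF.hafAlgo k).comp (h.pair h.length.range)) []

/-- The algorithm computes the hafnian modulo `2 ^ k` of every symmetric integer matrix. -/
theorem fullAlgo_encodeMatrix (k : ℕ) {m : ℕ} (A : Matrix (Fin m) (Fin m) ℤ) (hA : A.IsSymm) :
    fullAlgo k (encodeMatrix A).reverse =
      (Computability.encodeNat (hf A Finset.univ % 2 ^ k).toNat).reverse := by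
  have hN := Nat.two_pow_pos k
  set B : List (List ℕ) := (List.finRange m).map fun i => (List.finRange m).map fun j =>
    residue (2 ^ k) (A i j) with hB
  have hp : (encodeMatrix A).reverse.foldl (parseStep (2 ^ k)) [] = B := by
    rw [List.foldl_reverse]
    exact parseBack_encodeMatrix (2 ^ k) A
  have hlen : B.length = m := by simp [hB]
  have he : ∀ i j : Fin m, entry B i j = residue (2 ^ k) (A i j) := entry_map_finRange _
  have hvalid : Valid B (List.range m) := by
    refine ⟨fun i hi j hj => ?_, List.nodup_range, fun x hx => by simpa [hlen] using hx⟩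
    rw [hlen] at hi hj
    rw [he ⟨i, hi⟩ ⟨j, hj⟩, he ⟨j, hj⟩ ⟨i, hi⟩, hA.apply]
  have h1 := (ZMod.natCast_eq_natCast_iff _ _ _).2 (computes_hafAlgo k B _ hvalid)
  have h2 : (List.range m).toFinset = (Finset.univ : Finset (Fin m)).image Fin.val := by
    ext x
    simp only [List.mem_toFinset, List.mem_range, Finset.mem_image, Finset.mem_univ, true_and]
    exact ⟨fun h => ⟨⟨x, h⟩, rfl⟩, fun ⟨i, hi⟩ => hi ▸ i.2⟩
  rw [natCast_hf, h2, hf_image Fin.val Fin.val_injective _ _ (fun x _ y _ => by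
    rw [he, he, hA.apply])] at h1
  have h3 : ((hf A Finset.univ : ℤ) : ZMod (2 ^ k)) =
      hf (fun x y : Fin m => (entry B x y : ZMod (2 ^ k))) Finset.univ := by
    refine (map_hf (Int.castRingHom (ZMod (2 ^ k))) A Finset.univ).trans ?_
    refine hf_congr _ fun x _ y _ _ => ?_
    rw [he, natCast_residue hN]
    rfl
  rw [← h3] at h1
  have h4 : hafAlgo k (B, List.range m) = (hf A Finset.univ % 2 ^ k).toNat := by
    have h5 : ((hafAlgo k (B, List.range m) : ℤ) : ZMod (2 ^ k)) = (hf A Finset.univ : ℤ) := by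
      rw [← h1]; simp
    have h6 := (ZMod.intCast_eq_intCast_iff' _ _ _).1 h5
    have h7 := hafAlgo_lt k (B, List.range m)
    push_cast at h6
    rw [Int.emod_eq_of_lt (by positivity) (by exact_mod_cast h7)] at h6
    rw [← h6]
    simp
  unfold fullAlgo
  rw [hp, hlen, h4]
  have h8 := hafAlgo_lt k (B, List.range m)
  rw [h4] at h8
  rw [List.getD_eq_getElem?_getD, List.getElem?_map, List.getElem?_range h8]
  rfl

end HafnianModTwoPow

theorem mainTheorem8 :
    (∀ (n : ℕ) (A : Matrix (Fin (2 * n)) (Fin (2 * n)) ℤ), A.IsSymm →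
      2 ^ n * (n.factorial : ℤ) * HafnianModTwoPow.hafnian A = HafnianModTwoPow.hafnianSum A) ∧
    ∀ k : ℕ,
      HafnianModTwoPow.PolyTime HafnianModTwoPow.SymmMatrix.encode
        (HafnianModTwoPow.hafnianMod k) ∧
      HafnianModTwoPow.PolyTime HafnianModTwoPow.FinGraph.encode
        (HafnianModTwoPow.numPerfectMatchingsMod k) := by
  classical
  refine ⟨fun n A hA => ?_, fun k =>
    ⟨HafnianModTwoPow.polyTime_of_PF (HafnianModTwoPow.PF.fullAlgo k) fun X => ?_,
      HafnianModTwoPow.polyTime_of_PF (HafnianModTwoPow.PF.fullAlgo k) fun X => ?_⟩⟩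
  · rw [HafnianModTwoPow.hafnian_eq A hA, HafnianModTwoPow.hafnianSum_eq A hA]
  · rw [HafnianModTwoPow.SymmMatrix.encode, HafnianModTwoPow.fullAlgo_encodeMatrix k X.A X.symm,
      HafnianModTwoPow.hafnianMod, HafnianModTwoPow.hafnian_eq X.A X.symm]
  · rw [HafnianModTwoPow.FinGraph.encode, HafnianModTwoPow.fullAlgo_encodeMatrix k _
      (X.G.isSymm_adjMatrix), HafnianModTwoPow.numPerfectMatchingsMod,
      HafnianModTwoPow.hf_adjMatrix]
    congr 2
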